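/- Let $I=[a,b]\subset\mathbb{R}$ with $a<b$, and let $f:I\to\mathbb{R}$ be twice continuously differentiable with $f''(x)\neq 0$ for all $x\in I$ (equivalently, by compactness, $c_1\le |f''(x)|\le c_2$ on $I$ for some constants $0<c_1\le c_2<\infty$). For $\theta=(\theta_1,\theta_2)\in\mathbb{R}^2$, real $Q\ge 1$ and $\delta>0$, put $$N_\theta(Q,\delta):=\operatorname{card}\Bigl\{(p_1,q)\in\mathbb{Z}\times\mathbb{N}:\ Q<q\le 2Q,\ \frac{p_1+\theta_1}{q}\in I,\ \Bigl\|q f\Bigl(\frac{p_1+\theta_1}{q}\Bigr)-\theta_2\Bigr\|<\delta\Bigr\},$$ where $\|x\|$ denotes the distance from $x$ to the nearest integer. Then there is a constant $C>0$, depending only on $f$ and $I$, such that for all $\theta\in\mathbb{R}^2$, all real $Q\ge 1$ and all $0<\delta\le\frac12$ the number $N_\theta(Q,\delta)$ is finite and $$N_\theta(Q,\delta)\le C\bigl(\delta Q^2+\delta^{-1/2}Q\bigr).$$ -/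

import Mathlib

/-- `distNearestInt x` is `‖x‖`, the distance from the real number `x` to the nearest integer. -/
noncomputable def distNearestInt (x : ℝ) : ℝ := |x - (round x : ℝ)|

/-- The pairs `(p₁, q) ∈ ℤ × ℕ` with `Q < q ≤ 2Q`, `(p₁ + θ₁)/q ∈ I` and
`‖q f((p₁ + θ₁)/q) - θ₂‖ < δ`, where `θ = (θ₁, θ₂)`. -/
def shiftedRationalPoints (f : ℝ → ℝ) (I : Set ℝ) (θ : ℝ × ℝ) (Q δ : ℝ) : Set (ℤ × ℕ) :=
  {x | Q < (x.2 : ℝ) ∧ (x.2 : ℝ) ≤ 2 * Q ∧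
    ((x.1 : ℝ) + θ.1) / (x.2 : ℝ) ∈ I ∧
    distNearestInt ((x.2 : ℝ) * f (((x.1 : ℝ) + θ.1) / (x.2 : ℝ)) - θ.2) < δ}

/-- The counting function `N_θ(Q, δ)`. -/
noncomputable def shiftedRationalCount (f : ℝ → ℝ) (I : Set ℝ) (θ : ℝ × ℝ) (Q δ : ℝ) : ℕ :=
  (shiftedRationalPoints f I θ Q δ).ncard

/-! Counting points near the graph is turned into counting lines nearly tangent to it. Take f'' > 0
and δ^(3/2) Q ≥ 1, where the bound to prove is of order δQ². Cut I into arcs of length √(δ/Q). Over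
one arc the triples (q, p₁, p₂), with p₂ the nearest integer, lie in a sheared box with sides of
order Q, √(Qδ), δ, because q times the deviation of f from its tangent is O(δ). By
`card_mul_le_card_dual` their number is at most a constant times the volume times the number of
integer (a, b, c) in the dual box: |c| ≤ H, |b + c f'(x)| ≤ σ, |a + b x + c f(x)| ≤ σ²/H, with H of
order 1/δ and σ of order (Qδ)^(-1/2). The shift θ only moves the centre of the first box and
disappears. The zero vectors contribute δQ² over all arcs. A nonzero vector is a line nearly tangent
at a grid point, so it suffices to bound the incidences by the number of arcs, of order H/σ
(`exists_card_incidences_le`).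

By convexity a line with c of order C is nearly tangent at O(H/C) grid points, so the lines of each
dyadic height C must be counted. Cut I into cells of length of order 1/C. Three lines nearly tangent
in one cell have an integer determinant smaller than 1 in absolute value, hence 0; so the primitive
lines of a cell, if there are at least two, meet in a rational point of some denominator q ≤ C. On
each side of that point their slopes are q/(4C²)-separated and spread over O(σ/C), which leaves O(1
+ σC/q) lines, while only O(q) cells share the same q. Summation gives O(C + σC^(3/2)) primitive
lines (`exists_card_primitive_nearTangent_le`), and imprimitive ones cost at most a further C^(1/4)
in the first term (`exists_card_nearTangent_le`). The condition δ^(3/2) Q ≥ 1 enters as σ²√H ≤ 1,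
which is what the sum over heights needs. Smaller δ are enlarged to Q^(-2/3). -/

/-! ### Duality between integer points of a sheared box and of its dual box -/

/-- Parseval for a sum of distinct characters of a finite abelian group. -/
theorem sum_norm_sq_sum_addChar {G ι : Type*} [AddCommGroup G] [Fintype G] (A : Finset ι)
    (χ : ι → AddChar G ℂ) (hχ : Set.InjOn χ A) :
    ∑ g, ‖∑ n ∈ A, χ n g‖ ^ 2 = (A.card : ℝ) * Fintype.card G := by
  classical
  have key : ∀ g, ((‖∑ n ∈ A, χ n g‖ ^ 2 : ℝ) : ℂ) = ∑ n ∈ A, ∑ m ∈ A, (χ n - χ m) g := by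
    intro g
    rw [← Complex.normSq_eq_norm_sq, ← Complex.mul_conj, map_sum, Finset.sum_mul_sum]
    refine Finset.sum_congr rfl fun n _ => Finset.sum_congr rfl fun m _ => ?_
    rw [AddChar.sub_apply, AddChar.map_neg_eq_conj]
  have : ((∑ g, ‖∑ n ∈ A, χ n g‖ ^ 2 : ℝ) : ℂ) = ((A.card : ℝ) * Fintype.card G : ℝ) := by
    rw [Complex.ofReal_sum, Finset.sum_congr rfl fun g _ => key g, Finset.sum_comm]
    have h1 : ∀ n ∈ A, ∑ g, ∑ m ∈ A, (χ n - χ m) g = (Fintype.card G : ℂ) := by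
      intro n hn
      rw [Finset.sum_comm, Finset.sum_eq_single n]
      · rw [AddChar.sum_eq_ite]; simp
      · intro m hm hmn
        rw [AddChar.sum_eq_ite, if_neg]
        intro h
        exact hmn (hχ hm hn (sub_eq_zero.mp h).symm)
      · intro h; exact absurd hn h
    rw [Finset.sum_congr rfl h1]
    simp
  exact_mod_cast this

/-- The linear form on `(ℤ/M)³` with the given coefficients. -/
def zmodForm (M : ℕ) (n : ℤ × ℤ × ℤ) : ZMod M × ZMod M × ZMod M →+ ZMod M where
  toFun g := n.1 * g.1 + n.2.1 * g.2.1 + n.2.2 * g.2.2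
  map_zero' := by simp
  map_add' x y := by simp; ring

/-- The additive character of `(ℤ/M)³` with frequency `n`. -/
noncomputable def zmodChar (M : ℕ) [NeZero M] (n : ℤ × ℤ × ℤ) :
    AddChar (ZMod M × ZMod M × ZMod M) ℂ :=
  (ZMod.stdAddChar (N := M)).compAddMonoidHom (zmodForm M n)

theorem zmodChar_apply_intCast (M : ℕ) [NeZero M] (n k : ℤ × ℤ × ℤ) :
    zmodChar M n ((k.1 : ZMod M), (k.2.1 : ZMod M), (k.2.2 : ZMod M)) =
      Complex.exp (2 * Real.pi * Complex.I *
        ((n.1 * k.1 + n.2.1 * k.2.1 + n.2.2 * k.2.2 : ℤ) : ℂ) / M) := by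
  rw [← ZMod.stdAddChar_coe]
  simp [zmodChar, zmodForm]

theorem Int.eq_of_cast_zmod_eq {M : ℕ} {W a b : ℤ} (h : (a : ZMod M) = b) (ha : |a| ≤ W)
    (hb : |b| ≤ W) (hW : 2 * W < M) : a = b := by
  have h1 : (M : ℤ) ∣ a - b := by
    rw [← ZMod.intCast_zmod_eq_zero_iff_dvd]; simp [h]
  have h2 : |a - b| < M := by
    rw [abs_lt]; rw [abs_le] at ha hb; omega
  have := Int.eq_zero_of_abs_lt_dvd h1 h2
  omega

theorem zmodChar_injOn (M : ℕ) [NeZero M] (A : Set (ℤ × ℤ × ℤ)) (W : ℤ)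
    (hA : ∀ n ∈ A, |n.1| ≤ W ∧ |n.2.1| ≤ W ∧ |n.2.2| ≤ W) (hW : 2 * W < M) :
    Set.InjOn (zmodChar M) A := by
  rintro ⟨a, b, c⟩ hn ⟨a', b', c'⟩ hm h
  obtain ⟨h1, h2, h3⟩ := hA _ hn
  obtain ⟨h1', h2', h3'⟩ := hA _ hm
  have e : ∀ g, zmodForm M (a, b, c) g = zmodForm M (a', b', c') g := fun g =>
    ZMod.injective_stdAddChar (DFunLike.congr_fun h g)
  have e1 := e (1, 0, 0)
  have e2 := e (0, 1, 0)
  have e3 := e (0, 0, 1)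
  simp [zmodForm] at e1 e2 e3
  rw [Int.eq_of_cast_zmod_eq e1 h1 h1' hW, Int.eq_of_cast_zmod_eq e2 h2 h2' hW,
    Int.eq_of_cast_zmod_eq e3 h3 h3' hW]

/-- A sum of unit complex numbers whose arguments are close to a common value is large. -/
theorem card_div_two_le_norm_sum_exp {ι : Type*} (A : Finset ι) (t : ι → ℝ) (φ : ℝ)
    (h : ∀ n ∈ A, |t n - φ| ≤ 1) :
    (A.card : ℝ) / 2 ≤ ‖∑ n ∈ A, Complex.exp (t n * Complex.I)‖ := by
  have h1 : ‖∑ n ∈ A, Complex.exp (t n * Complex.I)‖ =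
      ‖∑ n ∈ A, Complex.exp ((t n - φ : ℝ) * Complex.I)‖ := by
    have : ∑ n ∈ A, Complex.exp ((t n - φ : ℝ) * Complex.I) =
        Complex.exp ((-φ : ℝ) * Complex.I) * ∑ n ∈ A, Complex.exp (t n * Complex.I) := by
      rw [Finset.mul_sum]
      refine Finset.sum_congr rfl fun n _ => ?_
      rw [← Complex.exp_add]; congr 1; push_cast; ring
    rw [this, norm_mul, Complex.norm_exp_ofReal_mul_I, one_mul]
  rw [h1]
  refine le_trans ?_ (Complex.re_le_norm _)
  rw [Complex.re_sum]
  have : ∀ n ∈ A, (1 / 2 : ℝ) ≤ (Complex.exp ((t n - φ : ℝ) * Complex.I)).re := by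
    intro n hn
    rw [Complex.exp_ofReal_mul_I_re]
    have h2 : (t n - φ) ^ 2 ≤ 1 := by
      rw [← sq_abs]; have := h n hn; have := abs_nonneg (t n - φ); nlinarith
    linarith [Real.one_sub_sq_div_two_le_cos (x := t n - φ)]
  calc (A.card : ℝ) / 2 = ∑ n ∈ A, (1 / 2 : ℝ) := by simp; ring
    _ ≤ _ := Finset.sum_le_sum this

/-- The dual point attached to an index in the one-sided sheared box. -/
noncomputable def shearPoint (x0 y0 z0 : ℝ) (s : ℕ × ℕ × ℕ) : ℤ × ℤ × ℤ :=
  let k3 : ℤ := s.2.2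
  let k2 : ℤ := ⌈-(z0 * k3)⌉ + s.2.1
  (⌈-(x0 * k2 + y0 * k3)⌉ + s.1, k2, k3)

theorem shearPoint_injective (x0 y0 z0 : ℝ) : Function.Injective (shearPoint x0 y0 z0) := by
  rintro ⟨a, b, c⟩ ⟨a', b', c'⟩ h
  simp only [shearPoint, Prod.mk.injEq] at h
  obtain ⟨h1, h2, h3⟩ := h
  obtain rfl : c = c' := by exact_mod_cast h3
  obtain rfl : b = b' := by simpa using h2
  obtain rfl : a = a' := by simpa using h1
  rfl

theorem Int.ceil_neg_add_natCast_add_mem (t : ℝ) {s N : ℕ} (hs : s < N) :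
    0 ≤ ((⌈-t⌉ + s : ℤ) : ℝ) + t ∧ ((⌈-t⌉ + s : ℤ) : ℝ) + t ≤ N := by
  have h1 := Int.le_ceil (-t)
  have h2 := Int.ceil_lt_add_one (-t)
  have h3 : (s : ℝ) + 1 ≤ N := by exact_mod_cast hs
  have h4 : (0 : ℝ) ≤ s := by positivity
  push_cast
  constructor <;> linarith

/-- The coordinates are kept in `[0, N]` rather than `[-N, N]`, so that a difference of two such
points is again at most `N` in each coordinate. This is what places the fibres modulo `M` inside the
dual box itself and not its double. -/
theorem shearPoint_mem (x0 y0 z0 : ℝ) {N1 N2 N3 : ℕ} {s : ℕ × ℕ × ℕ}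
    (hs : s ∈ Finset.range N1 ×ˢ Finset.range N2 ×ˢ Finset.range N3) :
    let k := shearPoint x0 y0 z0 s
    (0 ≤ (k.2.2 : ℝ) ∧ (k.2.2 : ℝ) ≤ N3) ∧
    (0 ≤ (k.2.1 : ℝ) + z0 * k.2.2 ∧ (k.2.1 : ℝ) + z0 * k.2.2 ≤ N2) ∧
    (0 ≤ (k.1 : ℝ) + (x0 * k.2.1 + y0 * k.2.2) ∧
      (k.1 : ℝ) + (x0 * k.2.1 + y0 * k.2.2) ≤ N1) := by
  simp only [Finset.mem_product, Finset.mem_range] at hs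
  obtain ⟨h1, h2, h3⟩ := hs
  refine ⟨⟨by simp [shearPoint], ?_⟩, Int.ceil_neg_add_natCast_add_mem _ h2,
    Int.ceil_neg_add_natCast_add_mem _ h1⟩
  simp only [shearPoint, Int.cast_natCast]
  exact_mod_cast h3.le

theorem abs_sub_le_of_mem {u v N : ℝ} (hu : 0 ≤ u ∧ u ≤ N) (hv : 0 ≤ v ∧ v ≤ N) :
    |u - v| ≤ N := by
  rw [abs_le]; constructor <;> linarith [hu.1, hu.2, hv.1, hv.2]

/-- The number of integer points in a sheared box is bounded by its volume times the number of
integer points in the dual box. -/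
theorem card_mul_le_card_dual (x0 y0 z0 g1 g2 g3 R1 R2 R3 r1 r2 r3 : ℝ)
    (hr1 : 0 < r1) (hr2 : 0 < r2) (hr3 : 0 < r3)
    (hR : 2 * Real.pi * (R1 * r1 + R2 * r2 + R3 * r3) ≤ 1) (A B : Finset (ℤ × ℤ × ℤ))
    (hA : ∀ n ∈ A, |(n.1 : ℝ) - g1| ≤ R1 ∧ |(n.2.1 : ℝ) - n.1 * x0 - g2| ≤ R2 ∧
      |(n.2.2 : ℝ) - n.1 * y0 - (n.2.1 - n.1 * x0) * z0 - g3| ≤ R3)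
    (hB : ∀ m : ℤ × ℤ × ℤ, |(m.2.2 : ℝ)| ≤ r3 → |(m.2.1 : ℝ) + z0 * m.2.2| ≤ r2 →
      |(m.1 : ℝ) + (x0 * m.2.1 + y0 * m.2.2)| ≤ r1 → m ∈ B) :
    (A.card : ℝ) * (r1 * r2 * r3) ≤ 32 * B.card := by
  classical
  rcases A.eq_empty_or_nonempty with rfl | hne
  · simp
  obtain ⟨W, hW⟩ : ∃ W : ℤ, ∀ n ∈ A, |n.1| ≤ W ∧ |n.2.1| ≤ W ∧ |n.2.2| ≤ W := by
    refine ⟨∑ n ∈ A, (|n.1| + |n.2.1| + |n.2.2|), fun n hn => ?_⟩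
    have := Finset.single_le_sum (f := fun n : ℤ × ℤ × ℤ => |n.1| + |n.2.1| + |n.2.2|)
      (fun _ _ => by positivity) hn
    have h1 := abs_nonneg n.1
    have h2 := abs_nonneg n.2.1
    have h3 := abs_nonneg n.2.2
    exact ⟨by linarith, by linarith, by linarith⟩
  -- `M * rᵢ ≥ 2` lets the floors lose at most a factor 2; `M > 2W` keeps the frequencies in `A`
  -- distinct modulo `M`.
  obtain ⟨M, hM1, hM2, hM3, hMW⟩ : ∃ M : ℕ, 2 ≤ M * r1 ∧ 2 ≤ M * r2 ∧ 2 ≤ M * r3 ∧ 2 * W < M := by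
    have hl : ∀ r : ℝ, 0 < r → ∀ᶠ M : ℕ in Filter.atTop, 2 ≤ M * r := fun r hr =>
      (tendsto_natCast_atTop_atTop.atTop_mul_const hr).eventually_ge_atTop 2
    have hw : ∀ᶠ M : ℕ in Filter.atTop, 2 * W < M := by
      filter_upwards [Filter.eventually_gt_atTop (2 * W).toNat] with M hM
      omega
    exact ((hl r1 hr1).and ((hl r2 hr2).and ((hl r3 hr3).and hw))).exists
  have hM0 : M ≠ 0 := by rintro rfl; norm_num at hM1
  have : NeZero M := ⟨hM0⟩
  have hMpos : (0 : ℝ) < M := by positivity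
  set N1 := ⌊M * r1⌋₊
  set N2 := ⌊M * r2⌋₊
  set N3 := ⌊M * r3⌋₊
  have hfl : ∀ t : ℝ, 2 ≤ t → t / 2 ≤ (⌊t⌋₊ : ℝ) := fun t ht => by
    have := Nat.sub_one_lt_floor t; linarith
  have hfu : ∀ t : ℝ, 2 ≤ t → (⌊t⌋₊ : ℝ) ≤ t := fun t ht => Nat.floor_le (by linarith)
  set S := Finset.range N1 ×ˢ Finset.range N2 ×ˢ Finset.range N3
  let k : ℕ × ℕ × ℕ → ℤ × ℤ × ℤ := shearPoint x0 y0 z0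
  let π : ℕ × ℕ × ℕ → ZMod M × ZMod M × ZMod M := fun s =>
    (((k s).1 : ZMod M), ((k s).2.1 : ZMod M), ((k s).2.2 : ZMod M))
  let T : ZMod M × ZMod M × ZMod M → ℝ := fun g => ‖∑ n ∈ A, zmodChar M n g‖ ^ 2
  -- The two shears are dual, so `n · k` is the plain pairing of the sheared coordinates. These are
  -- within `Rᵢ` of the centre and at most `M * rᵢ`, so by `hR` all phases agree to within one
  -- radian.
  have hlow : ∀ s ∈ S, ((A.card : ℝ) / 2) ^ 2 ≤ T (π s) := by
    intro s hs
    obtain ⟨h3, h2, h1⟩ := shearPoint_mem x0 y0 z0 hs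
    refine pow_le_pow_left₀ (by positivity) ?_ 2
    change _ ≤ ‖∑ n ∈ A, zmodChar M n (((k s).1 : ZMod M), ((k s).2.1 : ZMod M),
      ((k s).2.2 : ZMod M))‖
    simp only [zmodChar_apply_intCast]
    set u3 : ℝ := ((k s).2.2 : ℝ)
    set u2 : ℝ := (k s).2.1 + z0 * (k s).2.2
    set u1 : ℝ := (k s).1 + (x0 * (k s).2.1 + y0 * (k s).2.2)
    have := card_div_two_le_norm_sum_exp A
      (fun n => 2 * Real.pi * ((n.1 * (k s).1 + n.2.1 * (k s).2.1 + n.2.2 * (k s).2.2 : ℤ) : ℝ) / M)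
      (2 * Real.pi * (g1 * u1 + g2 * u2 + g3 * u3) / M) ?_
    · convert this using 5 with n
      push_cast
      ring
    · intro n hn
      obtain ⟨ha, hb, hc⟩ := hA n hn
      have e : 2 * Real.pi * ((n.1 * (k s).1 + n.2.1 * (k s).2.1 + n.2.2 * (k s).2.2 : ℤ) : ℝ) / M
          - 2 * Real.pi * (g1 * u1 + g2 * u2 + g3 * u3) / M
          = 2 * Real.pi * (((n.1 : ℝ) - g1) * u1 + ((n.2.1 : ℝ) - n.1 * x0 - g2) * u2
            + ((n.2.2 : ℝ) - n.1 * y0 - (n.2.1 - n.1 * x0) * z0 - g3) * u3) / M := by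
        simp only [u1, u2, u3]; push_cast; ring
      rw [e, abs_div, abs_mul, abs_of_pos hMpos, abs_of_pos (by positivity : 0 < 2 * Real.pi),
        div_le_one hMpos]
      have hu1 : |u1| ≤ M * r1 := by rw [abs_of_nonneg h1.1]; exact h1.2.trans (hfu _ hM1)
      have hu2 : |u2| ≤ M * r2 := by rw [abs_of_nonneg h2.1]; exact h2.2.trans (hfu _ hM2)
      have hu3 : |u3| ≤ M * r3 := by rw [abs_of_nonneg h3.1]; exact h3.2.trans (hfu _ hM3)
      have hm : ∀ {x y X Y : ℝ}, |x| ≤ X → |y| ≤ Y → |x * y| ≤ X * Y := fun hx hy => by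
        rw [abs_mul]; exact mul_le_mul hx hy (abs_nonneg _) ((abs_nonneg _).trans hx)
      have hs := (abs_add_three (((n.1 : ℝ) - g1) * u1) (((n.2.1 : ℝ) - n.1 * x0 - g2) * u2)
        (((n.2.2 : ℝ) - n.1 * y0 - (n.2.1 - n.1 * x0) * z0 - g3) * u3)).trans
        (add_le_add (add_le_add (hm ha hu1) (hm hb hu2)) (hm hc hu3))
      calc _ ≤ 2 * Real.pi * (R1 * (M * r1) + R2 * (M * r2) + R3 * (M * r3)) := by gcongr
        _ = M * (2 * Real.pi * (R1 * r1 + R2 * r2 + R3 * r3)) := by ring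
        _ ≤ M * 1 := by gcongr
        _ = M := mul_one _
  -- Samples with equal residues differ by `M` times an integer vector of the dual box; relative to
  -- a fixed `s0` this vector determines the sample.
  have hfib : ∀ g, (S.filter fun s => π s = g).card ≤ B.card := by
    intro g
    rcases (S.filter fun s => π s = g).eq_empty_or_nonempty with h | ⟨s0, hs0⟩
    · simp [h]
    obtain ⟨hs0S, hs0g⟩ := Finset.mem_filter.mp hs0
    let d : ℕ × ℕ × ℕ → ℤ × ℤ × ℤ := fun s =>
      (((k s).1 - (k s0).1) / M, ((k s).2.1 - (k s0).2.1) / M, ((k s).2.2 - (k s0).2.2) / M)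
    have hd : ∀ s ∈ S.filter fun s => π s = g, (k s).1 = (k s0).1 + M * (d s).1 ∧
        (k s).2.1 = (k s0).2.1 + M * (d s).2.1 ∧ (k s).2.2 = (k s0).2.2 + M * (d s).2.2 := by
      intro s hs
      have hπ : π s = π s0 := (Finset.mem_filter.mp hs).2.trans hs0g.symm
      simp only [π, Prod.mk.injEq] at hπ
      have hdv : ∀ {x y : ℤ}, (x : ZMod M) = y → x = y + M * ((x - y) / M) := by
        intro x y h
        have : (M : ℤ) ∣ x - y := by
          rw [← ZMod.intCast_zmod_eq_zero_iff_dvd]; simp [h]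
        rw [Int.mul_ediv_cancel' this]; ring
      exact ⟨hdv hπ.1, hdv hπ.2.1, hdv hπ.2.2⟩
    refine Finset.card_le_card_of_injOn d ?_ ?_
    · intro s hs
      obtain ⟨e1, e2, e3⟩ := hd s hs
      obtain ⟨h3, h2, h1⟩ := shearPoint_mem x0 y0 z0 (Finset.mem_filter.mp hs).1
      obtain ⟨h3', h2', h1'⟩ := shearPoint_mem x0 y0 z0 hs0S
      have a3 := abs_sub_le_of_mem h3 h3'
      have a2 := abs_sub_le_of_mem h2 h2'
      have a1 := abs_sub_le_of_mem h1 h1'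
      change |((k s).2.2 : ℝ) - (k s0).2.2| ≤ _ at a3
      change |((k s).2.1 : ℝ) + z0 * (k s).2.2 - ((k s0).2.1 + z0 * (k s0).2.2)| ≤ _ at a2
      change |((k s).1 : ℝ) + (x0 * (k s).2.1 + y0 * (k s).2.2)
        - ((k s0).1 + (x0 * (k s0).2.1 + y0 * (k s0).2.2))| ≤ _ at a1
      rw [e1, e2, e3] at a1
      rw [e2, e3] at a2
      rw [e3] at a3
      push_cast at a1 a2 a3
      have hc : ∀ {x r : ℝ}, |M * x| ≤ M * r → |x| ≤ r := fun {x r} h => by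
        rw [abs_mul, abs_of_pos hMpos] at h; exact le_of_mul_le_mul_left h hMpos
      refine hB _ (hc ?_) (hc ?_) (hc ?_)
      · refine le_trans (le_of_eq ?_) (a3.trans (hfu _ hM3)); congr 1; ring
      · refine le_trans (le_of_eq ?_) (a2.trans (hfu _ hM2)); congr 1; ring
      · refine le_trans (le_of_eq ?_) (a1.trans (hfu _ hM1)); congr 1; ring
    · intro s hs s' hs' h
      obtain ⟨e1, e2, e3⟩ := hd s hs
      obtain ⟨e1', e2', e3'⟩ := hd s' hs'
      rw [h] at e1 e2 e3
      exact shearPoint_injective x0 y0 z0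
        (Prod.ext (e1.trans e1'.symm) (Prod.ext (e2.trans e2'.symm) (e3.trans e3'.symm)))
  have hsum : ∑ s ∈ S, T (π s) ≤ B.card * ((A.card : ℝ) * (M : ℝ) ^ 3) := by
    have hP : ∑ g, T g = (A.card : ℝ) * (M : ℝ) ^ 3 := by
      rw [sum_norm_sq_sum_addChar A (zmodChar M) (zmodChar_injOn M A W hW hMW)]
      simp [ZMod.card]; ring_nf; simp
    rw [Finset.sum_comp T π, ← hP, Finset.mul_sum]
    calc _ ≤ ∑ g ∈ S.image π, (B.card : ℝ) * T g := by
          refine Finset.sum_le_sum fun g _ => ?_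
          rw [nsmul_eq_mul]
          have := hfib g
          have hT : 0 ≤ T g := by positivity
          gcongr
      _ ≤ _ := Finset.sum_le_sum_of_subset_of_nonneg (Finset.subset_univ _)
          fun g _ _ => by positivity
  have hlow' : (S.card : ℝ) * ((A.card : ℝ) / 2) ^ 2 ≤ ∑ s ∈ S, T (π s) := by
    have := Finset.card_nsmul_le_sum S _ _ hlow
    rwa [nsmul_eq_mul] at this
  have hScard : (M : ℝ) ^ 3 * (r1 * r2 * r3) / 8 ≤ S.card := by
    have : (S.card : ℝ) = N1 * N2 * N3 := by simp [S]; ring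
    rw [this]
    calc (M : ℝ) ^ 3 * (r1 * r2 * r3) / 8 = (M * r1 / 2) * (M * r2 / 2) * (M * r3 / 2) := by ring
      _ ≤ _ := by
        have h1 := hfl _ hM1
        have h2 := hfl _ hM2
        have h3 := hfl _ hM3
        gcongr
  have hApos : (0 : ℝ) < A.card := by exact_mod_cast hne.card_pos
  -- The factor 32 is 8 from the three floors times 4 from squaring the lower bound `A.card / 2`.
  have hfin : (M : ℝ) ^ 3 * (r1 * r2 * r3) / 8 * ((A.card : ℝ) / 2) ^ 2
      ≤ B.card * ((A.card : ℝ) * (M : ℝ) ^ 3) :=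
    (mul_le_mul_of_nonneg_right hScard (by positivity)).trans (hlow'.trans hsum)
  have hpos : (0 : ℝ) < A.card * (M : ℝ) ^ 3 := by positivity
  refine le_of_mul_le_mul_left ?_ hpos
  nlinarith [hfin]

/-! ### Quadratic convexity -/

/-- `f` lies between two parabolas above each of its tangent lines `y ↦ f y + g y (x - y)`. -/
def QuadraticallyConvexOn (I : Set ℝ) (c₁ c₂ : ℝ) (f g : ℝ → ℝ) : Prop :=
  ∀ x ∈ I, ∀ y ∈ I, c₁ / 2 * (x - y) ^ 2 ≤ f x - f y - g y * (x - y) ∧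
    f x - f y - g y * (x - y) ≤ c₂ / 2 * (x - y) ^ 2

namespace QuadraticallyConvexOn

variable {I : Set ℝ} {c₁ c₂ : ℝ} {f g : ℝ → ℝ}

/-- Adding the tangent inequalities at `(x, y)` and `(y, x)` cancels the values of `f`. -/
theorem slope_mul_ge (h : QuadraticallyConvexOn I c₁ c₂ f g) {x y : ℝ} (hx : x ∈ I) (hy : y ∈ I) :
    c₁ * (x - y) ^ 2 ≤ (g x - g y) * (x - y) := by
  have h1 := (h x hx y hy).1
  have h2 := (h y hy x hx).1
  nlinarith

theorem slope_mul_le (h : QuadraticallyConvexOn I c₁ c₂ f g) {x y : ℝ} (hx : x ∈ I) (hy : y ∈ I) :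
    (g x - g y) * (x - y) ≤ c₂ * (x - y) ^ 2 := by
  have h1 := (h x hx y hy).2
  have h2 := (h y hy x hx).2
  nlinarith

theorem le_abs_slope_sub (h : QuadraticallyConvexOn I c₁ c₂ f g) {x y : ℝ} (hx : x ∈ I)
    (hy : y ∈ I) : c₁ * |x - y| ≤ |g x - g y| := by
  rcases eq_or_ne x y with rfl | hne
  · simp
  have hp : 0 < |x - y| := abs_pos.mpr (sub_ne_zero.mpr hne)
  refine le_of_mul_le_mul_right ?_ hp
  calc c₁ * |x - y| * |x - y| = c₁ * (x - y) ^ 2 := by rw [mul_assoc, abs_mul_abs_self]; ring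
    _ ≤ (g x - g y) * (x - y) := h.slope_mul_ge hx hy
    _ ≤ |(g x - g y) * (x - y)| := le_abs_self _
    _ = _ := abs_mul _ _

theorem abs_slope_sub_le (h : QuadraticallyConvexOn I c₁ c₂ f g) (h0 : 0 ≤ c₁) {x y : ℝ}
    (hx : x ∈ I) (hy : y ∈ I) : |g x - g y| ≤ c₂ * |x - y| := by
  rcases eq_or_ne x y with rfl | hne
  · simp
  have hp : 0 < |x - y| := abs_pos.mpr (sub_ne_zero.mpr hne)
  refine le_of_mul_le_mul_right ?_ hp
  have h1 : 0 ≤ (g x - g y) * (x - y) := le_trans (by positivity) (h.slope_mul_ge hx hy)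
  calc |g x - g y| * |x - y| = |(g x - g y) * (x - y)| := (abs_mul _ _).symm
    _ = (g x - g y) * (x - y) := abs_of_nonneg h1
    _ ≤ c₂ * (x - y) ^ 2 := h.slope_mul_le hx hy
    _ = c₂ * |x - y| * |x - y| := by rw [mul_assoc, abs_mul_abs_self]; ring

theorem abs_remainder_le (h : QuadraticallyConvexOn I c₁ c₂ f g) (h0 : 0 ≤ c₁) {x y : ℝ}
    (hx : x ∈ I) (hy : y ∈ I) : |f x - f y - g y * (x - y)| ≤ c₂ / 2 * |x - y| ^ 2 := by
  have := h x hx y hy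
  rw [abs_of_nonneg (le_trans (by positivity) this.1), sq_abs]
  exact this.2

end QuadraticallyConvexOn

/-! ### Lines as integer vectors, primitivity and concurrence -/

/-- The value at `x` of the integral linear combination `a + b x + c f x`. -/
def dualForm (f : ℝ → ℝ) (v : ℤ × ℤ × ℤ) (x : ℝ) : ℝ := v.1 + v.2.1 * x + v.2.2 * f x

/-- The value at `x` of `b + c g x`. -/
def dualSlope (g : ℝ → ℝ) (v : ℤ × ℤ × ℤ) (x : ℝ) : ℝ := v.2.1 + v.2.2 * g x

/-- The line `a + b x + c y = 0` with `C ≤ c < 2 C` is nearly tangent to the graph of `f`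
at `x`. -/
structure NearTangent (f g : ℝ → ℝ) (I : Set ℝ) (C σ : ℝ) (v : ℤ × ℤ × ℤ) (x : ℝ) : Prop where
  mem : x ∈ I
  le : C ≤ v.2.2
  lt : (v.2.2 : ℝ) < 2 * C
  form : |dualForm f v x| ≤ σ ^ 2 / C
  slope : |dualSlope g v x| ≤ σ

/-- The determinant of three integer vectors. -/
def tripleDet (u v w : ℤ × ℤ × ℤ) : ℤ :=
  w.1 * (u.2.1 * v.2.2 - v.2.1 * u.2.2) + w.2.1 * (u.2.2 * v.1 - v.2.2 * u.1)
    + w.2.2 * (u.1 * v.2.1 - v.1 * u.2.1)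

/-- The dot product of integer vectors. -/
def tripleDot (u w : ℤ × ℤ × ℤ) : ℤ := u.1 * w.1 + u.2.1 * w.2.1 + u.2.2 * w.2.2

/-- An integer vector with coprime entries. -/
def IsPrimitiveTriple (v : ℤ × ℤ × ℤ) : Prop := ∃ u, tripleDot v u = 1

/-- The map `(a, b, c) ↦ (a + b x + c f x, b + c g x, c)` has determinant 1, so the determinant may
be computed in coordinates that are small for nearly tangent lines. -/
theorem tripleDet_eq_dual (f g : ℝ → ℝ) (x : ℝ) (u v w : ℤ × ℤ × ℤ) :
    (tripleDet u v w : ℝ) =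
      dualForm f w x * (dualSlope g u x * v.2.2 - dualSlope g v x * u.2.2)
      + dualSlope g w x * (u.2.2 * dualForm f v x - v.2.2 * dualForm f u x)
      + w.2.2 * (dualForm f u x * dualSlope g v x - dualForm f v x * dualSlope g u x) := by
  simp only [tripleDet, dualForm, dualSlope]; push_cast; ring

theorem exists_primitive_smul (v : ℤ × ℤ × ℤ) (hv : v ≠ 0) :
    ∃ (d : ℕ) (w : ℤ × ℤ × ℤ), 0 < d ∧ IsPrimitiveTriple w ∧
      v.1 = d * w.1 ∧ v.2.1 = d * w.2.1 ∧ v.2.2 = d * w.2.2 := by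
  obtain ⟨a, b, c⟩ := v
  set e := Int.gcd a b
  set d := Int.gcd e c
  have hd : 0 < d := by
    rw [Nat.pos_iff_ne_zero]
    intro h
    obtain ⟨he, hc⟩ := Int.gcd_eq_zero_iff.mp h
    obtain ⟨ha, hb⟩ := Int.gcd_eq_zero_iff.mp (by exact_mod_cast he : Int.gcd a b = 0)
    exact hv (by simp [ha, hb, hc])
  have hde : (d : ℤ) ∣ e := Int.gcd_dvd_left ..
  obtain ⟨a', ha⟩ := hde.trans (Int.gcd_dvd_left (a := a) (b := b))
  obtain ⟨b', hb⟩ := hde.trans (Int.gcd_dvd_right (a := a) (b := b))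
  obtain ⟨c', hc⟩ : (d : ℤ) ∣ c := Int.gcd_dvd_right ..
  refine ⟨d, (a', b', c'), hd, ?_, ha, hb, hc⟩
  have e1 : (e : ℤ) = a * Int.gcdA a b + b * Int.gcdB a b := Int.gcd_eq_gcd_ab a b
  have e2 : (d : ℤ) = e * Int.gcdA e c + c * Int.gcdB e c := Int.gcd_eq_gcd_ab e c
  refine ⟨(Int.gcdA a b * Int.gcdA e c, Int.gcdB a b * Int.gcdA e c, Int.gcdB e c), ?_⟩
  have hd' : (d : ℤ) ≠ 0 := by exact_mod_cast hd.ne'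
  refine mul_left_cancel₀ hd' ?_
  simp only [tripleDot]
  linear_combination (-(Int.gcdA a b * Int.gcdA e c)) * ha - (Int.gcdB a b * Int.gcdA e c) * hb
    - Int.gcdB e c * hc - e2 - Int.gcdA e c * e1

/-- Proportional primitive vectors with positive last entry are equal. -/
theorem IsPrimitiveTriple.eq_of_proportional {v w : ℤ × ℤ × ℤ} (hv : IsPrimitiveTriple v)
    (hw : IsPrimitiveTriple w) (hv0 : 0 < v.2.2) (hw0 : 0 < w.2.2)
    (h1 : v.1 * w.2.2 = w.1 * v.2.2) (h2 : v.2.1 * w.2.2 = w.2.1 * v.2.2) : v = w := by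
  obtain ⟨a, b, c⟩ := v
  obtain ⟨a', b', c'⟩ := w
  obtain ⟨⟨r, s, t⟩, hr⟩ := hv
  obtain ⟨⟨r', s', t'⟩, hr'⟩ := hw
  simp only [tripleDot] at *
  have d1 : c' ∣ c := ⟨a * r' + b * s' + c * t', by
    linear_combination (-c) * hr' - r' * h1 - s' * h2⟩
  have d2 : c ∣ c' := ⟨a' * r + b' * s + c' * t, by
    linear_combination (-c') * hr + r * h1 + s * h2⟩
  obtain rfl : c = c' := Int.dvd_antisymm hv0.le hw0.le d2 d1
  rw [mul_right_cancel₀ hv0.ne' h1, mul_right_cancel₀ hv0.ne' h2]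

/-- The plane spanned by two integer vectors has a primitive normal vector. -/
theorem exists_primitive_normal (u v : ℤ × ℤ × ℤ) (h : u.2.1 * v.2.2 - v.2.1 * u.2.2 ≠ 0) :
    ∃ w : ℤ × ℤ × ℤ, IsPrimitiveTriple w ∧ 0 < w.1 ∧
      ∀ z, tripleDet u v z = 0 → tripleDot z w = 0 := by
  -- The normal is the cross product of `u` and `v` made primitive; its first entry comes from the
  -- minor in `h`, hence is nonzero, and its sign is adjusted below.
  obtain ⟨d, w, hd, ⟨r, hr⟩, h1, h2, h3⟩ := exists_primitive_smul
    (u.2.1 * v.2.2 - v.2.1 * u.2.2, u.2.2 * v.1 - v.2.2 * u.1, u.1 * v.2.1 - v.1 * u.2.1)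
    (by intro h0; exact h (congrArg Prod.fst h0))
  simp only at h1 h2 h3
  have hd' : (d : ℤ) ≠ 0 := by exact_mod_cast hd.ne'
  have hz : ∀ z, tripleDet u v z = 0 → tripleDot z w = 0 := by
    intro z hz
    refine (mul_eq_zero.mp (?_ : (d : ℤ) * tripleDot z w = 0)).resolve_left hd'
    rw [← hz, tripleDet, tripleDot, h1, h2, h3]; ring
  have hw : w.1 ≠ 0 := by
    intro h0; rw [h0, mul_zero] at h1; exact h h1
  rcases lt_or_gt_of_ne hw with hneg | hpos
  · refine ⟨-w, ⟨-r, ?_⟩, by simpa using hneg, fun z h0 => ?_⟩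
    · simpa [tripleDot] using hr
    · have := hz z h0
      simp only [tripleDot, Prod.fst_neg, Prod.snd_neg] at this ⊢
      linarith
  · exact ⟨w, ⟨r, hr⟩, hpos, hz⟩

/-- Two vectors orthogonal to a primitive `(q, p₁, p₂)` have a minor divisible by `q`. -/
theorem dvd_minor_of_tripleDot_eq_zero {u v w : ℤ × ℤ × ℤ} (hw : IsPrimitiveTriple w)
    (hu : tripleDot u w = 0) (hv : tripleDot v w = 0) :
    w.1 ∣ u.2.1 * v.2.2 - v.2.1 * u.2.2 := by
  obtain ⟨q, p, p'⟩ := w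
  obtain ⟨⟨r, s, t⟩, hr⟩ := hw
  obtain ⟨a, b, c⟩ := u
  obtain ⟨a', b', c'⟩ := v
  simp only [tripleDot] at *
  -- The cross product is a multiple of the primitive `w`; pairing it with the Bézout vector `(r, s,
  -- t)` reads off the multiplier.
  refine ⟨(b * c' - b' * c) * r + (c * a' - c' * a) * s + (a * b' - a' * b) * t, ?_⟩
  linear_combination (-(b * c' - b' * c)) * hr + s * (c' * hu - c * hv)
    + t * (b * hv - b' * hu)

/-! ### Two elementary counting bounds -/

/-- A finite set of `h`-separated reals of diameter at most `D` has at most `1 + D / h` elements. -/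
theorem card_le_of_separated {ι : Type*} (S : Finset ι) (φ : ι → ℝ) {h D : ℝ} (hh : 0 < h)
    (hD : 0 ≤ D) (hsep : ∀ i ∈ S, ∀ j ∈ S, i ≠ j → h ≤ |φ i - φ j|)
    (hdiam : ∀ i ∈ S, ∀ j ∈ S, |φ i - φ j| ≤ D) : (S.card : ℝ) ≤ 1 + D / h := by
  classical
  rcases S.eq_empty_or_nonempty with rfl | hne
  · simp; positivity
  obtain ⟨m, hm, hmin⟩ := S.exists_min_image φ hne
  have hcard : S.card ≤ (Finset.range (⌊D / h⌋₊ + 1)).card := by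
    refine Finset.card_le_card_of_injOn (fun i => ⌊(φ i - φ m) / h⌋₊) ?_ ?_
    · intro i hi
      simp only [Finset.coe_range, Set.mem_Iio, Nat.lt_succ_iff]
      refine Nat.floor_le_floor ?_
      gcongr
      exact (le_abs_self _).trans (hdiam i hi m hm)
    · intro i hi j hj hij
      by_contra hne'
      have h1 := hsep i hi j hj hne'
      have pi : 0 ≤ (φ i - φ m) / h := div_nonneg (sub_nonneg.mpr (hmin i hi)) hh.le
      have pj : 0 ≤ (φ j - φ m) / h := div_nonneg (sub_nonneg.mpr (hmin j hj)) hh.le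
      have i1 := Nat.floor_le pi
      have i2 := Nat.lt_floor_add_one ((φ i - φ m) / h)
      have j1 := Nat.floor_le pj
      have j2 := Nat.lt_floor_add_one ((φ j - φ m) / h)
      simp only at hij
      rw [hij] at i1 i2
      have : |(φ i - φ m) / h - (φ j - φ m) / h| < 1 := by
        rw [abs_lt]; constructor <;> linarith
      rw [← sub_div, abs_div, abs_of_pos hh, div_lt_one hh] at this
      have e : φ i - φ m - (φ j - φ m) = φ i - φ j := by ring
      rw [e] at this
      linarith
  rw [Finset.card_range] at hcard
  have : (S.card : ℝ) ≤ ⌊D / h⌋₊ + 1 := by exact_mod_cast hcard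
  linarith [Nat.floor_le (div_nonneg hD hh.le)]

/-- If each level `k` of `q` has at most `K k` elements, the sum of reciprocals of `q` is small. -/
theorem sum_inv_le_of_card_level_le {ι : Type*} (S : Finset ι) (q : ι → ℕ) {K R : ℝ} (hK : 0 ≤ K)
    (hR : 0 < R) (hq : ∀ i ∈ S, 0 < q i)
    (hlev : ∀ k : ℕ, ((S.filter fun i => q i = k).card : ℝ) ≤ K * k) :
    ∑ i ∈ S, (1 / (q i : ℝ)) ≤ K * R + S.card / R := by
  classical
  -- Each level `k ≤ R` contributes at most `K * k` terms `1 / k`, that is `K`; every term beyond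
  -- `R` is at most `1 / R`.
  rw [← Finset.sum_filter_add_sum_filter_not S (fun i => (q i : ℝ) ≤ R)]
  refine add_le_add ?_ ?_
  · have hmaps : ∀ i ∈ S.filter (fun i => (q i : ℝ) ≤ R), q i ∈ Finset.Icc 1 ⌊R⌋₊ := by
      intro i hi
      obtain ⟨h1, h2⟩ := Finset.mem_filter.mp hi
      exact Finset.mem_Icc.mpr ⟨hq i h1, Nat.le_floor h2⟩
    rw [← Finset.sum_fiberwise_of_maps_to hmaps]
    calc _ ≤ ∑ k ∈ Finset.Icc 1 ⌊R⌋₊, K := by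
          refine Finset.sum_le_sum fun k hk => ?_
          have hk0 : (0 : ℝ) < k := by exact_mod_cast (Finset.mem_Icc.mp hk).1
          calc _ = ∑ i ∈ (S.filter fun i => (q i : ℝ) ≤ R).filter fun i => q i = k,
                  (1 / (k : ℝ)) :=
                Finset.sum_congr rfl fun i hi => by rw [(Finset.mem_filter.mp hi).2]
            _ = ((S.filter fun i => (q i : ℝ) ≤ R).filter fun i => q i = k).card / k := by
                rw [Finset.sum_const, nsmul_eq_mul]; ring
            _ ≤ (S.filter fun i => q i = k).card / (k : ℝ) := by
                gcongr
                exact Finset.filter_subset _ _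
            _ ≤ K * k / k := by gcongr; exact hlev k
            _ = K := by field_simp
      _ = K * ⌊R⌋₊ := by simp; ring
      _ ≤ K * R := by gcongr; exact Nat.floor_le hR.le
  · calc _ ≤ ∑ i ∈ S.filter (fun i => ¬ (q i : ℝ) ≤ R), 1 / R := by
          refine Finset.sum_le_sum fun i hi => ?_
          have := (Finset.mem_filter.mp hi).2
          gcongr
          exact (not_le.mp this).le
      _ ≤ ∑ i ∈ S, 1 / R := Finset.sum_le_sum_of_subset_of_nonneg (Finset.filter_subset _ _)
          fun _ _ _ => by positivity
      _ = _ := by simp; ring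

theorem abs_mul_le_mul {x y X Y : ℝ} (hx : |x| ≤ X) (hy : |y| ≤ Y) : |x * y| ≤ X * Y := by
  rw [abs_mul]; exact mul_le_mul hx hy (abs_nonneg _) ((abs_nonneg _).trans hx)

/-! ### Geometry of nearly tangent lines -/

namespace NearTangent

variable {I : Set ℝ} {c₁ c₂ C σ η : ℝ} {f g : ℝ → ℝ} {u v w : ℤ × ℤ × ℤ} {x y z : ℝ}

theorem last_pos (hv : NearTangent f g I C σ v x) (hC : 0 < C) : (0 : ℝ) < v.2.2 :=
  hC.trans_le hv.le

theorem abs_last_le (hv : NearTangent f g I C σ v x) (hC : 0 < C) : |(v.2.2 : ℝ)| ≤ 2 * C := by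
  rw [abs_of_pos (hv.last_pos hC)]; exact hv.lt.le

/-- Near tangency at `x` persists, with a loss, at nearby points. -/
theorem transfer (hf : QuadraticallyConvexOn I c₁ c₂ f g) (h1 : 0 ≤ c₁) (h2 : 0 ≤ c₂) (hC : 0 < C)
    (hσ : 0 ≤ σ) (hση : σ ≤ η) (hv : NearTangent f g I C σ v x) (hy : y ∈ I)
    (hxy : |x - y| ≤ η / C) :
    |dualForm f v y| ≤ (2 + c₂) * η ^ 2 / C ∧ |dualSlope g v y| ≤ (1 + 2 * c₂) * η := by
  have hη : 0 ≤ η := hσ.trans hση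
  have hc := hv.abs_last_le hC
  have hyx : |y - x| ≤ η / C := by rwa [abs_sub_comm]
  constructor
  -- Taylor expansion at `x`: the linear coefficient is the slope defect, and the quadratic
  -- remainder is multiplied by the last entry, at most `2C`.
  · have e : dualForm f v y = dualForm f v x + dualSlope g v x * (y - x)
        + v.2.2 * (f y - f x - g x * (y - x)) := by
      simp only [dualForm, dualSlope]; ring
    have r1 : |f y - f x - g x * (y - x)| ≤ c₂ / 2 * (η / C) ^ 2 :=
      (hf.abs_remainder_le h1 hy hv.mem).trans (by gcongr)
    rw [e]
    calc _ ≤ |dualForm f v x| + |dualSlope g v x * (y - x)|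
          + |v.2.2 * (f y - f x - g x * (y - x))| := abs_add_three _ _ _
      _ ≤ σ ^ 2 / C + σ * (η / C) + 2 * C * (c₂ / 2 * (η / C) ^ 2) :=
        add_le_add (add_le_add hv.form (abs_mul_le_mul hv.slope hyx)) (abs_mul_le_mul hc r1)
      _ ≤ η ^ 2 / C + η * (η / C) + 2 * C * (c₂ / 2 * (η / C) ^ 2) := by gcongr
      _ = _ := by field_simp; ring
  · have e : dualSlope g v y = dualSlope g v x + v.2.2 * (g y - g x) := by
      simp only [dualSlope]; ring
    have r1 : |g y - g x| ≤ c₂ * (η / C) :=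
      (hf.abs_slope_sub_le h1 hy hv.mem).trans (by gcongr)
    rw [e]
    calc _ ≤ |dualSlope g v x| + |v.2.2 * (g y - g x)| := abs_add_le _ _
      _ ≤ η + 2 * C * (c₂ * (η / C)) := add_le_add (hv.slope.trans hση) (abs_mul_le_mul hc r1)
      _ = _ := by field_simp

/-- Three lines nearly tangent at nearby points are concurrent. -/
theorem tripleDet_eq_zero (hf : QuadraticallyConvexOn I c₁ c₂ f g) (h1 : 0 ≤ c₁) (h2 : 0 ≤ c₂)
    (hC : 0 < C) (hσ : 0 ≤ σ) (hση : σ ≤ η) (hη : 100 * (1 + c₂) * η ≤ 1)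
    (hu : NearTangent f g I C σ u x) (hv : NearTangent f g I C σ v y)
    (hw : NearTangent f g I C σ w z) (hxy : |y - x| ≤ η / C) (hxz : |z - x| ≤ η / C) :
    tripleDet u v w = 0 := by
  have hη0 : 0 ≤ η := hσ.trans hση
  have hxx : |x - x| ≤ η / C := by simp; positivity
  obtain ⟨fu, su⟩ := hu.transfer hf h1 h2 hC hσ hση hu.mem hxx
  obtain ⟨fv, sv⟩ := hv.transfer hf h1 h2 hC hσ hση hu.mem hxy
  obtain ⟨fw, sw⟩ := hw.transfer hf h1 h2 hC hσ hση hu.mem hxz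
  have cu := hu.abs_last_le hC
  have cv := hv.abs_last_le hC
  have cw := hw.abs_last_le hC
  set A := (2 + c₂) * η ^ 2 / C with hA
  set B := (1 + 2 * c₂) * η with hB
  have hdet := tripleDet_eq_dual f g x u v w
  have hb : |(tripleDet u v w : ℝ)| ≤ 6 * (A * (B * (2 * C))) := by
    rw [hdet]
    have t1 := abs_mul_le_mul fw ((abs_sub _ _).trans
      (add_le_add (abs_mul_le_mul su cv) (abs_mul_le_mul sv cu)))
    have t2 := abs_mul_le_mul sw ((abs_sub _ _).trans
      (add_le_add (abs_mul_le_mul cu fv) (abs_mul_le_mul cv fu)))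
    have t3 := abs_mul_le_mul cw ((abs_sub _ _).trans
      (add_le_add (abs_mul_le_mul fu sv) (abs_mul_le_mul fv su)))
    refine ((abs_add_three _ _ _).trans (add_le_add (add_le_add t1 t2) t3)).trans (le_of_eq ?_)
    ring
  -- The factors `C` cancel, so a bound on `η` depending on `c₂` alone forces the integer to vanish.
  have hlt : 6 * (A * (B * (2 * C))) < 1 := by
    have e : 6 * (A * (B * (2 * C))) = 12 * ((2 + c₂) * η) * ((1 + 2 * c₂) * η) * η := by
      rw [hA, hB]; field_simp; ring
    have i1 : (2 + c₂) * η ≤ 1 / 50 := by nlinarith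
    have i2 : (1 + 2 * c₂) * η ≤ 1 / 50 := by nlinarith
    have i3 : η ≤ 1 / 100 := by nlinarith
    rw [e]
    calc _ ≤ 12 * (1 / 50) * (1 / 50) * (1 / 100 : ℝ) := by gcongr
      _ < 1 := by norm_num
  have : |tripleDet u v w| < 1 := by exact_mod_cast hb.trans_lt hlt
  exact Int.abs_lt_one_iff.mp this

/-- Two lines nearly tangent at nearby points cannot be parallel and distinct. -/
theorem proportional_of_minor_eq_zero (hf : QuadraticallyConvexOn I c₁ c₂ f g) (h1 : 0 ≤ c₁)
    (h2 : 0 ≤ c₂) (hC : 0 < C) (hσ : 0 ≤ σ) (hση : σ ≤ η) (hη : 100 * (1 + c₂) * η ≤ 1)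
    (hu : NearTangent f g I C σ u x) (hv : NearTangent f g I C σ v y) (hxy : |y - x| ≤ η / C)
    (h : u.2.1 * v.2.2 - v.2.1 * u.2.2 = 0) : u.1 * v.2.2 = v.1 * u.2.2 := by
  have hη0 : 0 ≤ η := hσ.trans hση
  have hxx : |x - x| ≤ η / C := by simp; positivity
  have fu := (hu.transfer hf h1 h2 hC hσ hση hu.mem hxx).1
  have fv := (hv.transfer hf h1 h2 hC hσ hση hu.mem hxy).1
  have cu := hu.abs_last_le hC
  have cv := hv.abs_last_le hC
  have hR : (u.2.1 : ℝ) * v.2.2 - v.2.1 * u.2.2 = 0 := by exact_mod_cast h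
  have e : ((u.1 * v.2.2 - v.1 * u.2.2 : ℤ) : ℝ)
      = v.2.2 * dualForm f u x - u.2.2 * dualForm f v x := by
    simp only [dualForm]; push_cast; linear_combination (-x) * hR
  have hb : |((u.1 * v.2.2 - v.1 * u.2.2 : ℤ) : ℝ)| < 1 := by
    rw [e]
    calc _ ≤ 2 * C * ((2 + c₂) * η ^ 2 / C) + 2 * C * ((2 + c₂) * η ^ 2 / C) :=
          (abs_sub _ _).trans (add_le_add (abs_mul_le_mul cv fu) (abs_mul_le_mul cu fv))
      _ = 4 * ((2 + c₂) * η) * η := by field_simp; ring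
      _ ≤ 4 * (1 / 50) * (1 / 100) := by
        gcongr <;> nlinarith
      _ < 1 := by norm_num
  have : |u.1 * v.2.2 - v.1 * u.2.2| < 1 := by exact_mod_cast hb
  have := Int.abs_lt_one_iff.mp this
  omega

theorem abs_minor_le (hf : QuadraticallyConvexOn I c₁ c₂ f g) (h1 : 0 ≤ c₁) (h2 : 0 ≤ c₂)
    (hC : 0 < C) (hσ : 0 ≤ σ) (hση : σ ≤ η) (hη : 100 * (1 + c₂) * η ≤ 1)
    (hu : NearTangent f g I C σ u x) (hv : NearTangent f g I C σ v y) (hxy : |y - x| ≤ η / C) :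
    |((u.2.1 * v.2.2 - v.2.1 * u.2.2 : ℤ) : ℝ)| ≤ C := by
  have hη0 : 0 ≤ η := hσ.trans hση
  have hxx : |x - x| ≤ η / C := by simp; positivity
  have su := (hu.transfer hf h1 h2 hC hσ hση hu.mem hxx).2
  have sv := (hv.transfer hf h1 h2 hC hσ hση hu.mem hxy).2
  have cu := hu.abs_last_le hC
  have cv := hv.abs_last_le hC
  have e : ((u.2.1 * v.2.2 - v.2.1 * u.2.2 : ℤ) : ℝ)
      = dualSlope g u x * v.2.2 - dualSlope g v x * u.2.2 := by
    simp only [dualSlope]; push_cast; ring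
  rw [e]
  calc _ ≤ (1 + 2 * c₂) * η * (2 * C) + (1 + 2 * c₂) * η * (2 * C) :=
        (abs_sub _ _).trans (add_le_add (abs_mul_le_mul su cv) (abs_mul_le_mul sv cu))
    _ = 4 * ((1 + 2 * c₂) * η) * C := by ring
    _ ≤ 4 * (1 / 50) * C := by gcongr; nlinarith
    _ ≤ C := by linarith

/-- The height over `y₁` at which the tangent at `x` differs from `y₂`, when the line passes
through `(y₁, y₂)`. -/
theorem abs_tangent_gap_le (hC : 0 < C) (hv : NearTangent f g I C σ v x) {y₁ y₂ : ℝ}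
    (hy : (v.1 : ℝ) + v.2.1 * y₁ + v.2.2 * y₂ = 0) :
    |f x - y₂ - g x * (x - y₁)| ≤ (σ / C) ^ 2 + σ / C * |x - y₁| := by
  have hc := hv.last_pos hC
  have e : v.2.2 * (f x - y₂ - g x * (x - y₁)) = dualForm f v x - dualSlope g v x * (x - y₁) := by
    simp only [dualForm, dualSlope]; linear_combination (-1) * hy
  have h1 : |v.2.2 * (f x - y₂ - g x * (x - y₁))| ≤ σ ^ 2 / C + σ * |x - y₁| := by
    rw [e]
    exact (abs_sub _ _).trans (add_le_add hv.form (abs_mul_le_mul hv.slope le_rfl))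
  rw [abs_mul, abs_of_pos hc] at h1
  have h2 : C * |f x - y₂ - g x * (x - y₁)| ≤ σ ^ 2 / C + σ * |x - y₁| :=
    (mul_le_mul_of_nonneg_right hv.le (abs_nonneg _)).trans h1
  refine le_of_mul_le_mul_left (h2.trans (le_of_eq ?_)) hC
  field_simp

theorem abs_slope_sub_le (hC : 0 < C) (hσ : 0 ≤ σ) (hv : NearTangent f g I C σ v x) :
    |(v.2.1 : ℝ) / v.2.2 + g x| ≤ σ / C := by
  have hc := hv.last_pos hC
  have e : (v.2.1 : ℝ) / v.2.2 + g x = dualSlope g v x / v.2.2 := by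
    simp only [dualSlope]; field_simp
  rw [e, abs_div, abs_of_pos hc]
  exact div_le_div₀ hσ hv.slope hC hv.le

/-- Contact points, on the same side of `y₁`, of nearly tangent lines through a common point
`(y₁, y₂)` are close together. -/
theorem abs_sub_le_of_concurrent (hf : QuadraticallyConvexOn I c₁ c₂ f g) (h1 : 0 < c₁)
    (hC : 0 < C) (hσ : 0 ≤ σ) (hu : NearTangent f g I C σ u x) (hv : NearTangent f g I C σ v y)
    {y₁ y₂ : ℝ} (hu0 : (u.1 : ℝ) + u.2.1 * y₁ + u.2.2 * y₂ = 0)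
    (hv0 : (v.1 : ℝ) + v.2.1 * y₁ + v.2.2 * y₂ = 0) (hside : 0 ≤ (x - y) * (y - y₁)) :
    |x - y| ≤ (4 / c₁ + 2) * (σ / C) := by
  set s := σ / C
  have hs : 0 ≤ s := by positivity
  have gu := hu.abs_tangent_gap_le hC hu0
  have gv := hv.abs_tangent_gap_le hC hv0
  rcases eq_or_ne x y with rfl | hne
  · simp; positivity
  have hΔ : 0 < |x - y| := abs_pos.mpr (sub_ne_zero.mpr hne)
  have hxy1 : |x - y₁| ≤ |x - y| + |y - y₁| := abs_sub_le _ _ _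
  have hrem := (hf y hv.mem x hu.mem).1
  have hmul : c₁ * |x - y| * |y - y₁| ≤ (g x - g y) * (y - y₁) := by
    have hg := hf.slope_mul_ge hu.mem hv.mem
    rcases lt_or_gt_of_ne (sub_ne_zero.mpr hne) with hneg | hpos
    · have hd : y - y₁ ≤ 0 := by
        by_contra hcon; push Not at hcon; nlinarith [mul_neg_of_neg_of_pos hneg hcon]
      rw [abs_of_neg hneg, abs_of_nonpos hd]
      have : g x - g y ≤ c₁ * (x - y) := by
        by_contra hcon; push Not at hcon; nlinarith [mul_lt_mul_of_neg_right hcon hneg]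
      nlinarith [mul_le_mul_of_nonpos_right this hd]
    · have hd : 0 ≤ y - y₁ := by
        by_contra hcon; push Not at hcon; nlinarith [mul_neg_of_pos_of_neg hpos hcon]
      rw [abs_of_pos hpos, abs_of_nonneg hd]
      have : c₁ * (x - y) ≤ g x - g y := by
        by_contra hcon; push Not at hcon; nlinarith [mul_lt_mul_of_pos_right hcon hpos]
      nlinarith [mul_le_mul_of_nonneg_right this hd]
  -- By `hside`, `x` is not nearer to `y₁` than `y` and lies on the same side. Moving the contact
  -- point outward lowers the tangent over `y₁`: both terms on the right are nonnegative, while near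
  -- tangency bounds the two gaps on the left.
  have e : (f y - y₂ - g y * (y - y₁)) - (f x - y₂ - g x * (x - y₁))
      = (g x - g y) * (y - y₁) + (f y - f x - g x * (y - x)) := by ring
  have hub := le_trans (le_abs_self _) (abs_sub (f y - y₂ - g y * (y - y₁))
    (f x - y₂ - g x * (x - y₁)))
  rw [e] at hub
  have hsq : (y - x) ^ 2 = |x - y| ^ 2 := by rw [sq_abs]; ring
  rw [hsq] at hrem
  set Δ := |x - y|
  set d := |y - y₁|
  have hd0 : 0 ≤ d := abs_nonneg _
  have hmain : c₁ * Δ * d + c₁ / 2 * Δ ^ 2 ≤ 2 * s ^ 2 + s * (Δ + 2 * d) := by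
    nlinarith [mul_le_mul_of_nonneg_left hxy1 hs]
  by_contra hcon
  push Not at hcon
  have hcΔ : 4 * s + 2 * c₁ * s < c₁ * Δ := by
    have := mul_lt_mul_of_pos_left hcon h1
    calc _ = c₁ * ((4 / c₁ + 2) * s) := by field_simp
      _ < _ := this
  have k1 : 2 * s * d ≤ c₁ * Δ * d := by
    have : 2 * s ≤ c₁ * Δ := by linarith [mul_nonneg h1.le hs]
    exact mul_le_mul_of_nonneg_right this hd0
  have k2 : 2 * s ≤ Δ := by
    refine le_trans ?_ hcon.le
    have : 0 ≤ 4 / c₁ * s := by positivity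
    nlinarith
  have k3 : (4 * s) * Δ < c₁ * Δ * Δ := by
    refine mul_lt_mul_of_pos_right ?_ hΔ
    linarith [mul_nonneg h1.le hs]
  linarith [mul_le_mul_of_nonneg_left k2 hs]

/-- Up to sign, the slope of a line is within `σ / C` of `g` at its contact point, and `g` is
`c₂`-Lipschitz, so closeness of contact points passes to slopes. -/
theorem abs_line_slope_sub_le (hf : QuadraticallyConvexOn I c₁ c₂ f g) (h1 : 0 < c₁) (h2 : 0 ≤ c₂)
    (hC : 0 < C) (hσ : 0 ≤ σ) (hu : NearTangent f g I C σ u x) (hv : NearTangent f g I C σ v y)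
    {y₁ y₂ : ℝ} (hu0 : (u.1 : ℝ) + u.2.1 * y₁ + u.2.2 * y₂ = 0)
    (hv0 : (v.1 : ℝ) + v.2.1 * y₁ + v.2.2 * y₂ = 0) (hside : 0 ≤ (x - y) * (y - y₁)) :
    |(u.2.1 : ℝ) / u.2.2 - v.2.1 / v.2.2| ≤ (2 + c₂ * (4 / c₁ + 2)) * (σ / C) := by
  have hx := hu.abs_slope_sub_le hC hσ
  have hy := hv.abs_slope_sub_le hC hσ
  have hg := (hf.abs_slope_sub_le h1.le hu.mem hv.mem).trans
    (mul_le_mul_of_nonneg_left (abs_sub_le_of_concurrent hf h1 hC hσ hu hv hu0 hv0 hside) h2)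
  have e : (u.2.1 : ℝ) / u.2.2 - v.2.1 / v.2.2
      = ((u.2.1 : ℝ) / u.2.2 + g x) - ((v.2.1 : ℝ) / v.2.2 + g y) - (g x - g y) := by ring
  rw [e]
  refine (abs_sub _ _).trans ((add_le_add ((abs_sub _ _).trans (add_le_add hx hy)) hg).trans
    (le_of_eq ?_))
  ring

/-- Lines with different slopes, nearly tangent at nearby points, meet near the contact point. -/
theorem abs_sub_concurrence_le (hf : QuadraticallyConvexOn I c₁ c₂ f g) (h1 : 0 ≤ c₁)
    (h2 : 0 ≤ c₂) (hC : 0 < C) (hσ : 0 ≤ σ) (hση : σ ≤ η) (hu : NearTangent f g I C σ u x)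
    (hv : NearTangent f g I C σ v y) {y₁ y₂ q : ℝ} (hu0 : (u.1 : ℝ) + u.2.1 * y₁ + u.2.2 * y₂ = 0)
    (hv0 : (v.1 : ℝ) + v.2.1 * y₁ + v.2.2 * y₂ = 0) (hxy : |y - x| ≤ η / C) (hq : 0 < q)
    (hminor : q ≤ |((u.2.1 * v.2.2 - v.2.1 * u.2.2 : ℤ) : ℝ)|) :
    |x - y₁| ≤ 8 * (2 + c₂) * η ^ 2 / q := by
  have hη0 : 0 ≤ η := hσ.trans hση
  have hxx : |x - x| ≤ η / C := by simp; positivity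
  have fu := (hu.transfer hf h1 h2 hC hσ hση hu.mem hxx).1
  have fv := (hv.transfer hf h1 h2 hC hσ hση hu.mem hxy).1
  have cu := hu.abs_last_le hC
  have cv := hv.abs_last_le hC
  -- Eliminating `f x` from the two forms leaves an affine function of `x` that vanishes at the
  -- meeting point and has the minor as leading coefficient.
  have e : ((u.2.1 * v.2.2 - v.2.1 * u.2.2 : ℤ) : ℝ) * (x - y₁)
      = v.2.2 * dualForm f u x - u.2.2 * dualForm f v x := by
    simp only [dualForm]; push_cast; linear_combination u.2.2 * hv0 - v.2.2 * hu0
  have hb : |((u.2.1 * v.2.2 - v.2.1 * u.2.2 : ℤ) : ℝ)| * |x - y₁| ≤ 4 * (2 + c₂) * η ^ 2 := by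
    rw [← abs_mul, e]
    refine ((abs_sub _ _).trans (add_le_add (abs_mul_le_mul cv fu) (abs_mul_le_mul cu fv))).trans
      (le_of_eq ?_)
    field_simp; ring
  rw [le_div_iff₀ hq]
  have := mul_le_mul_of_nonneg_right hminor (abs_nonneg (x - y₁))
  have : 0 ≤ 4 * (2 + c₂) * η ^ 2 := by positivity
  linarith

/-- The second coordinate of the point of concurrence is determined by the first. -/
theorem concurrence_height_close (hf : QuadraticallyConvexOn I c₁ c₂ f g) (h1 : 0 ≤ c₁)
    (h2 : 0 ≤ c₂) (hC : 0 < C) (hσ : 0 ≤ σ) (hu : NearTangent f g I C σ u x)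
    (hv : NearTangent f g I C σ v y) {y₁ y₂ y₂' D : ℝ}
    (hu0 : (u.1 : ℝ) + u.2.1 * y₁ + u.2.2 * y₂ = 0)
    (hv0 : (v.1 : ℝ) + v.2.1 * y₁ + v.2.2 * y₂' = 0) (hx : |x - y₁| ≤ D) (hy : |y - y₁| ≤ D) :
    |y₂ - y₂'| ≤ 4 * c₂ * D ^ 2 + 2 * ((σ / C) ^ 2 + σ / C * D) := by
  have hD : 0 ≤ D := (abs_nonneg _).trans hx
  have gu := hu.abs_tangent_gap_le hC hu0
  have gv := hv.abs_tangent_gap_le hC hv0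
  have hs : 0 ≤ σ / C := by positivity
  have gu' := gu.trans (add_le_add le_rfl (mul_le_mul_of_nonneg_left hx hs))
  have gv' := gv.trans (add_le_add le_rfl (mul_le_mul_of_nonneg_left hy hs))
  have hxy : |x - y| ≤ 2 * D := by
    have := abs_sub_le x y₁ y
    rw [abs_sub_comm y₁ y] at this
    linarith
  have e : y₂ - y₂' = (f y - y₂' - g y * (y - y₁)) - (f x - y₂ - g x * (x - y₁))
      - ((g x - g y) * (y - y₁) + (f y - f x - g x * (y - x))) := by ring
  have r1 := abs_mul_le_mul ((hf.abs_slope_sub_le h1 hu.mem hv.mem).trans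
    (mul_le_mul_of_nonneg_left hxy h2)) hy
  have r2 : |f y - f x - g x * (y - x)| ≤ c₂ / 2 * (2 * D) ^ 2 := by
    refine (hf.abs_remainder_le h1 hv.mem hu.mem).trans ?_
    rw [abs_sub_comm y x]; gcongr
  rw [e]
  refine ((abs_sub _ _).trans (add_le_add ((abs_sub _ _).trans (add_le_add gv' gu'))
    ((abs_add_le _ _).trans (add_le_add r1 r2)))).trans (le_of_eq ?_)
  ring

end NearTangent

/-! ### Lines and cells attached to a rational point -/

theorem concurrent_of_tripleDot_eq_zero {v w : ℤ × ℤ × ℤ} (hw : 0 < w.1)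
    (h : tripleDot v w = 0) :
    (v.1 : ℝ) + v.2.1 * ((w.2.1 : ℝ) / w.1) + v.2.2 * ((w.2.2 : ℝ) / w.1) = 0 := by
  have hw' : (w.1 : ℝ) ≠ 0 := by exact_mod_cast hw.ne'
  have : (v.1 : ℝ) * w.1 + v.2.1 * w.2.1 + v.2.2 * w.2.2 = 0 := by
    simp only [tripleDot] at h; exact_mod_cast h
  field_simp
  linarith

/-- Parallel lines with a common point coincide, and a line has only one primitive vector with
positive last entry. -/
theorem minor_ne_zero_of_concurrent {u v w : ℤ × ℤ × ℤ} (hu : IsPrimitiveTriple u)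
    (hv : IsPrimitiveTriple v) (hu0 : 0 < u.2.2) (hv0 : 0 < v.2.2) (huv : u ≠ v) (hw : 0 < w.1)
    (hud : tripleDot u w = 0) (hvd : tripleDot v w = 0) :
    u.2.1 * v.2.2 - v.2.1 * u.2.2 ≠ 0 := by
  intro h
  refine huv (hu.eq_of_proportional hv hu0 hv0 ?_ (by linarith))
  simp only [tripleDot] at hud hvd
  refine mul_right_cancel₀ hw.ne' ?_
  linear_combination v.2.2 * hud - u.2.2 * hvd - w.2.1 * h

theorem le_abs_minor_of_concurrent {u v w : ℤ × ℤ × ℤ} (hw1 : IsPrimitiveTriple w)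
    (hud : tripleDot u w = 0) (hvd : tripleDot v w = 0)
    (h : u.2.1 * v.2.2 - v.2.1 * u.2.2 ≠ 0) :
    (w.1 : ℝ) ≤ |((u.2.1 * v.2.2 - v.2.1 * u.2.2 : ℤ) : ℝ)| := by
  have := Int.le_of_dvd (abs_pos.mpr h)
    ((dvd_abs _ _).mpr (dvd_minor_of_tripleDot_eq_zero hw1 hud hvd))
  exact_mod_cast this

section

variable {I : Set ℝ} {c₁ c₂ C σ η : ℝ} {f g : ℝ → ℝ}

/-- Few primitive nearly tangent lines pass through a given rational point. -/
theorem card_concurrent_le (hf : QuadraticallyConvexOn I c₁ c₂ f g) (h1 : 0 < c₁) (h2 : 0 ≤ c₂)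
    (hC : 0 < C) (hσ : 0 ≤ σ) (V : Finset (ℤ × ℤ × ℤ)) (ξ : ℤ × ℤ × ℤ → ℝ)
    (hprim : ∀ v ∈ V, IsPrimitiveTriple v) (hV : ∀ v ∈ V, NearTangent f g I C σ v (ξ v))
    {w : ℤ × ℤ × ℤ} (hw1 : IsPrimitiveTriple w) (hw : 0 < w.1)
    (hdot : ∀ v ∈ V, tripleDot v w = 0) :
    (V.card : ℝ) ≤ 2 + 8 * (2 + c₂ * (4 / c₁ + 2)) * σ * C * (1 / w.1) := by
  classical
  set K := 2 + c₂ * (4 / c₁ + 2)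
  have hq : (0 : ℝ) < w.1 := by exact_mod_cast hw
  have hK : 0 ≤ K := by positivity
  -- A convex graph may have two tangents through one point, touching on either side of it, so the
  -- two sides are counted separately.
  have side : ∀ S ⊆ V, (∀ u ∈ S, ∀ v ∈ S, 0 ≤ (ξ u - ξ v) * (ξ v - (w.2.1 : ℝ) / w.1) ∨
      0 ≤ (ξ v - ξ u) * (ξ u - (w.2.1 : ℝ) / w.1)) →
      (S.card : ℝ) ≤ 1 + 4 * K * σ * C * (1 / w.1) := by
    intro S hS hside
    -- Distinct slopes differ by a nonzero multiple of the denominator `w.1` over a product of last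
    -- entries at most `4C²`.
    have := card_le_of_separated S (fun v => (v.2.1 : ℝ) / v.2.2) (h := w.1 / (4 * C ^ 2))
      (D := K * (σ / C)) (by positivity) (by positivity) ?_ ?_
    · refine this.trans (le_of_eq ?_)
      field_simp
    · intro u hu v hv huv
      have cu := (hV u (hS hu)).last_pos hC
      have cv := (hV v (hS hv)).last_pos hC
      have hm := le_abs_minor_of_concurrent hw1 (hdot u (hS hu)) (hdot v (hS hv))
        (minor_ne_zero_of_concurrent (hprim u (hS hu)) (hprim v (hS hv)) (by exact_mod_cast cu)
          (by exact_mod_cast cv) huv hw (hdot u (hS hu)) (hdot v (hS hv)))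
      have e : (u.2.1 : ℝ) / u.2.2 - v.2.1 / v.2.2
          = ((u.2.1 * v.2.2 - v.2.1 * u.2.2 : ℤ) : ℝ) / (u.2.2 * v.2.2) := by
        push_cast; field_simp
      simp only [e]
      rw [abs_div, abs_of_pos (mul_pos cu cv)]
      have hcc : (u.2.2 : ℝ) * v.2.2 ≤ 4 * C ^ 2 := by
        calc (u.2.2 : ℝ) * v.2.2 ≤ (2 * C) * (2 * C) :=
              mul_le_mul (hV u (hS hu)).lt.le (hV v (hS hv)).lt.le cv.le (by positivity)
          _ = _ := by ring
      exact div_le_div₀ (abs_nonneg _) hm (mul_pos cu cv) hcc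
    · intro u hu v hv
      have hu0 := concurrent_of_tripleDot_eq_zero hw (hdot u (hS hu))
      have hv0 := concurrent_of_tripleDot_eq_zero hw (hdot v (hS hv))
      rcases hside u hu v hv with h | h
      · exact (hV u (hS hu)).abs_line_slope_sub_le hf h1 h2 hC hσ (hV v (hS hv)) hu0 hv0 h
      · rw [abs_sub_comm]
        exact (hV v (hS hv)).abs_line_slope_sub_le hf h1 h2 hC hσ (hV u (hS hu)) hv0 hu0 h
  have s1 := side (V.filter fun v => (w.2.1 : ℝ) / w.1 ≤ ξ v) (Finset.filter_subset _ _) ?_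
  · have s2 := side (V.filter fun v => ¬ (w.2.1 : ℝ) / w.1 ≤ ξ v) (Finset.filter_subset _ _) ?_
    · have := Finset.card_filter_add_card_filter_not (s := V) (fun v => (w.2.1 : ℝ) / w.1 ≤ ξ v)
      have : (V.card : ℝ) = (V.filter fun v => (w.2.1 : ℝ) / w.1 ≤ ξ v).card
        + (V.filter fun v => ¬ (w.2.1 : ℝ) / w.1 ≤ ξ v).card := by exact_mod_cast this.symm
      linarith
    · intro u hu v hv
      have a := not_le.mp (Finset.mem_filter.mp hu).2
      have b := not_le.mp (Finset.mem_filter.mp hv).2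
      rcases le_total (ξ u) (ξ v) with h | h
      · left; exact mul_nonneg_of_nonpos_of_nonpos (by linarith) (by linarith)
      · right; exact mul_nonneg_of_nonpos_of_nonpos (by linarith) (by linarith)
  · intro u hu v hv
    have a := (Finset.mem_filter.mp hu).2
    have b := (Finset.mem_filter.mp hv).2
    rcases le_total (ξ v) (ξ u) with h | h
    · left; exact mul_nonneg (by linarith) (by linarith)
    · right; exact mul_nonneg (by linarith) (by linarith)

theorem Nat.abs_floor_sub_floor_le_one {s t : ℝ} (hs : 0 ≤ s) (ht : 0 ≤ t) (h : |s - t| ≤ 1) :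
    |(⌊s⌋₊ : ℝ) - ⌊t⌋₊| ≤ 1 := by
  have a := Nat.floor_le hs
  have b := Nat.lt_floor_add_one s
  have a' := Nat.floor_le ht
  have b' := Nat.lt_floor_add_one t
  rw [abs_le] at h
  have h1 : (⌊s⌋₊ : ℝ) < ⌊t⌋₊ + 2 := by linarith
  have h2 : (⌊t⌋₊ : ℝ) < ⌊s⌋₊ + 2 := by linarith
  have h1' : ⌊s⌋₊ < ⌊t⌋₊ + 2 := by exact_mod_cast h1
  have h2' : ⌊t⌋₊ < ⌊s⌋₊ + 2 := by exact_mod_cast h2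
  have h1'' : (⌊s⌋₊ : ℝ) ≤ ⌊t⌋₊ + 1 := by exact_mod_cast Nat.lt_succ_iff.mp h1'
  have h2'' : (⌊t⌋₊ : ℝ) ≤ ⌊s⌋₊ + 1 := by exact_mod_cast Nat.lt_succ_iff.mp h2'
  rw [abs_le]; constructor <;> linarith

/-- Few cells of length `η / C` contain contact points of lines concurrent at a rational point of
denominator `k`. -/
theorem card_cells_le {α β : ℝ} (hαβ : α < β)
    (hf : QuadraticallyConvexOn (Set.Icc α β) c₁ c₂ f g) (h1 : 0 < c₁) (h2 : 0 ≤ c₂)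
    (hC : 0 < C) (hσ : 0 ≤ σ) (hη0 : 0 < η) (hη : 100 * (1 + c₂) * η ≤ 1)
    (hση : (4 / c₁ + 2) * σ ≤ η) (S : Finset ℕ) (V W : ℕ → ℤ × ℤ × ℤ) (x : ℕ → ℝ)
    (hx : ∀ J ∈ S, J = ⌊(x J - α) * C / η⌋₊) (hW : ∀ J ∈ S, 0 < (W J).1)
    (hV : ∀ J ∈ S, NearTangent f g (Set.Icc α β) C σ (V J) (x J))
    (hVW : ∀ J ∈ S, tripleDot (V J) (W J) = 0) (hWC : ∀ J ∈ S, ((W J).1 : ℝ) ≤ C)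
    (hxW : ∀ J ∈ S, |x J - (W J).2.1 / (W J).1| ≤ 8 * (2 + c₂) * η ^ 2 / (W J).1) (k : ℕ) :
    ((S.filter fun J => (W J).1.toNat = k).card : ℝ) ≤ 4 * (β - α + 3) * k := by
  classical
  rcases Nat.eq_zero_or_pos k with rfl | hk
  · rw [Finset.filter_eq_empty_iff.mpr]
    · simp
    · intro J hJ h
      have := hW J hJ
      omega
  have hkR : (0 : ℝ) < k := by exact_mod_cast hk
  have hk1 : (1 : ℝ) ≤ k := by exact_mod_cast hk
  have hση' : σ ≤ η := by
    have : 0 ≤ 4 / c₁ * σ := by positivity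
    linarith
  set T := S.filter fun J => (W J).1.toNat = k
  have hT : ∀ J ∈ T, J ∈ S ∧ (W J).1 = k := fun J hJ => by
    obtain ⟨a, b⟩ := Finset.mem_filter.mp hJ
    have := hW J a
    exact ⟨a, by omega⟩
  have hTR : ∀ J ∈ T, ((W J).1 : ℝ) = k := fun J hJ => by exact_mod_cast (hT J hJ).2
  set ε := 8 * (2 + c₂) * η ^ 2 with hε
  have hε0 : 0 ≤ ε := by positivity
  have hηs : η ≤ 1 / 100 := by nlinarith
  have hcη : (2 + c₂) * η ≤ 1 / 50 := by nlinarith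
  have hεs : ε ≤ 1 / 500 := by
    calc ε = 8 * ((2 + c₂) * η) * η := by rw [hε]; ring
      _ ≤ 8 * (1 / 50) * (1 / 100) := by gcongr
      _ ≤ _ := by norm_num
  have hxT : ∀ J ∈ T, |x J - (W J).2.1 / k| ≤ ε / k := fun J hJ => by
    have := hxW J (hT J hJ).1
    rwa [hTR J hJ] at this
  -- Meeting points of denominator `k` over the same abscissa have heights less than `1 / k` apart,
  -- so the integer numerators agree.
  have hheight : ∀ J ∈ T, ∀ J' ∈ T, (W J).2.1 = (W J').2.1 → (W J).2.2 = (W J').2.2 := by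
    intro J hJ J' hJ' hp
    have hu0 := concurrent_of_tripleDot_eq_zero (hW J (hT J hJ).1) (hVW J (hT J hJ).1)
    have hv0 := concurrent_of_tripleDot_eq_zero (hW J' (hT J' hJ').1) (hVW J' (hT J' hJ').1)
    rw [hTR J hJ] at hu0
    rw [hTR J' hJ', ← hp] at hv0
    have hy := hxT J' hJ'
    rw [← hp] at hy
    have hb := (hV J (hT J hJ).1).concurrence_height_close hf h1.le h2 hC hσ
      (hV J' (hT J' hJ').1) hu0 hv0 (hxT J hJ) hy
    have hkC : (k : ℝ) ≤ C := by rw [← hTR J hJ]; exact hWC J (hT J hJ).1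
    have hs : σ / C ≤ η / k := div_le_div₀ hη0.le hση' hkR hkC
    have hs0 : 0 ≤ σ / C := by positivity
    have hb2 : |((W J).2.2 : ℝ) / k - (W J').2.2 / k|
        ≤ 4 * c₂ * (ε / k) ^ 2 + 2 * ((η / k) ^ 2 + η / k * (ε / k)) := hb.trans (by gcongr)
    have hb3 : |((W J).2.2 : ℝ) - (W J').2.2| < 1 := by
      rw [← sub_div, abs_div, abs_of_pos hkR, div_le_iff₀ hkR] at hb2
      have hcε : c₂ * ε ≤ 1 / 50 := by
        calc c₂ * ε = 8 * ((2 + c₂) * η) * (c₂ * η) := by rw [hε]; ring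
          _ ≤ 8 * (1 / 50) * (1 / 100) := by
            gcongr
            nlinarith
          _ ≤ _ := by norm_num
      calc _ ≤ _ := hb2
        _ = (4 * (c₂ * ε) * ε + 2 * (η * η + η * ε)) / k := by field_simp
        _ ≤ (4 * (c₂ * ε) * ε + 2 * (η * η + η * ε)) / 1 := by gcongr
        _ ≤ (4 * (1 / 50) * (1 / 500)
            + 2 * ((1 / 100) * (1 / 100) + (1 / 100) * (1 / 500))) / 1 := by gcongr
        _ < 1 := by norm_num
    have hb4 : |(W J).2.2 - (W J').2.2| < 1 := by exact_mod_cast hb3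
    have := Int.abs_lt_one_iff.mp hb4
    omega
  -- On one side of the meeting point the contact points are within `η / C` of each other, so the
  -- cell indices differ by at most 1: two cells per side, four in all.
  have hfib : ∀ p ∈ Finset.Icc ⌈k * (α - 1)⌉ ⌊k * (β + 1)⌋,
      (T.filter fun J => (W J).2.1 = p).card ≤ 4 := by
    intro p _
    have side : ∀ U ⊆ T.filter fun J => (W J).2.1 = p,
        (∀ J ∈ U, ∀ J' ∈ U, 0 ≤ (x J - x J') * (x J' - (p : ℝ) / k) ∨
          0 ≤ (x J' - x J) * (x J - (p : ℝ) / k)) → U.card ≤ 2 := by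
      intro U hU hside
      have hclose : ∀ J ∈ U, ∀ J' ∈ U, 0 ≤ (x J - x J') * (x J' - (p : ℝ) / k) →
          |(J : ℝ) - J'| ≤ 1 := by
        intro J hJ J' hJ' h
        obtain ⟨tJ, pJ⟩ := Finset.mem_filter.mp (hU hJ)
        obtain ⟨tJ', pJ'⟩ := Finset.mem_filter.mp (hU hJ')
        have hu0 := concurrent_of_tripleDot_eq_zero (hW J (hT J tJ).1) (hVW J (hT J tJ).1)
        have hv0 := concurrent_of_tripleDot_eq_zero (hW J' (hT J' tJ').1) (hVW J' (hT J' tJ').1)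
        have hz := hheight J tJ J' tJ' (pJ.trans pJ'.symm)
        rw [hTR J tJ, pJ] at hu0
        rw [hTR J' tJ', pJ', ← hz] at hv0
        have nJ := hV J (hT J tJ).1
        have nJ' := hV J' (hT J' tJ').1
        have hd := (nJ.abs_sub_le_of_concurrent hf h1 hC hσ nJ' hu0 hv0 h).trans
          (le_of_eq (mul_div_assoc _ _ _).symm)
        have hd' : |x J - x J'| ≤ η / C := hd.trans (by gcongr)
        have key := Nat.abs_floor_sub_floor_le_one (s := (x J - α) * C / η)
          (t := (x J' - α) * C / η)
          (div_nonneg (mul_nonneg (sub_nonneg.mpr nJ.mem.1) hC.le) hη0.le)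
          (div_nonneg (mul_nonneg (sub_nonneg.mpr nJ'.mem.1) hC.le) hη0.le) (by
            have e : (x J - α) * C / η - (x J' - α) * C / η = (x J - x J') * (C / η) := by ring
            rw [e, abs_mul, abs_of_pos (by positivity : 0 < C / η)]
            calc _ ≤ η / C * (C / η) := by gcongr
              _ = 1 := by field_simp)
        rwa [← hx J (hT J tJ).1, ← hx J' (hT J' tJ').1] at key
      have := card_le_of_separated U (fun J => (J : ℝ)) (h := 1) (D := 1) one_pos zero_le_one ?_ ?_
      · have : (U.card : ℝ) ≤ 2 := by linarith
        exact_mod_cast this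
      · intro i _ j _ hij
        have : (i : ℤ) - j ≠ 0 := by omega
        have := Int.one_le_abs this
        exact_mod_cast this
      · intro J hJ J' hJ'
        rcases hside J hJ J' hJ' with h | h
        · exact hclose J hJ J' hJ' h
        · rw [abs_sub_comm]; exact hclose J' hJ' J hJ h
    have s1 := side ((T.filter fun J => (W J).2.1 = p).filter fun J => (p : ℝ) / k ≤ x J)
      (Finset.filter_subset _ _) (by
        intro u hu v hv
        have a := (Finset.mem_filter.mp hu).2
        have b := (Finset.mem_filter.mp hv).2
        rcases le_total (x v) (x u) with h | h
        · left; exact mul_nonneg (by linarith) (by linarith)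
        · right; exact mul_nonneg (by linarith) (by linarith))
    have s2 := side ((T.filter fun J => (W J).2.1 = p).filter fun J => ¬ (p : ℝ) / k ≤ x J)
      (Finset.filter_subset _ _) (by
        intro u hu v hv
        have a := not_le.mp (Finset.mem_filter.mp hu).2
        have b := not_le.mp (Finset.mem_filter.mp hv).2
        rcases le_total (x u) (x v) with h | h
        · left; exact mul_nonneg_of_nonpos_of_nonpos (by linarith) (by linarith)
        · right; exact mul_nonneg_of_nonpos_of_nonpos (by linarith) (by linarith))
    have := Finset.card_filter_add_card_filter_not (s := T.filter fun J => (W J).2.1 = p)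
      (fun J => (p : ℝ) / k ≤ x J)
    omega
  have hmaps : ∀ J ∈ T, (W J).2.1 ∈ Finset.Icc ⌈k * (α - 1)⌉ ⌊k * (β + 1)⌋ := by
    intro J hJ
    have hm := (hV J (hT J hJ).1).mem
    have hd := hxT J hJ
    have : ε / k ≤ 1 := by rw [div_le_one hkR]; linarith
    have hd := abs_le.mp (hd.trans this)
    have e : ((W J).2.1 : ℝ) = k * ((W J).2.1 / k) := by field_simp
    rw [Finset.mem_Icc, Int.ceil_le, Int.le_floor, e]
    constructor
    · gcongr; linarith [hm.1]
    · gcongr; linarith [hm.2]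
  have hcard := Finset.card_le_mul_card_image_of_maps_to hmaps 4 hfib
  -- There are at most `k (β - α + 2) + 1` numerators, and `k ≥ 1` absorbs the 1.
  have hIcc : ((Finset.Icc ⌈k * (α - 1)⌉ ⌊k * (β + 1)⌋).card : ℝ) ≤ (β - α + 3) * k := by
    rw [Int.card_Icc]
    have a := Int.le_ceil (k * (α - 1))
    have b := Int.floor_le (k * (β + 1))
    have hnn : (0 : ℝ) ≤ (β - α + 3) * k := by
      have : 0 < β - α := sub_pos.mpr hαβ
      positivity
    rcases le_total (⌊k * (β + 1)⌋ + 1 - ⌈k * (α - 1)⌉) 0 with h | h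
    · rw [Int.toNat_of_nonpos h]; simpa using hnn
    · have : (((⌊k * (β + 1)⌋ + 1 - ⌈k * (α - 1)⌉).toNat : ℤ) : ℝ)
          = ((⌊k * (β + 1)⌋ + 1 - ⌈k * (α - 1)⌉ : ℤ) : ℝ) := by rw [Int.toNat_of_nonneg h]
      rw [← Int.cast_natCast, this]
      push_cast
      nlinarith
  calc (T.card : ℝ) ≤ 4 * (Finset.Icc ⌈k * (α - 1)⌉ ⌊k * (β + 1)⌋).card := by exact_mod_cast hcard
    _ ≤ 4 * ((β - α + 3) * k) := by gcongr
    _ = _ := by ring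

end

/-! ### Counting nearly tangent lines -/

/-- The number of primitive lines of height about `C` nearly tangent to the graph of `f`. -/
theorem exists_card_primitive_nearTangent_le {α β c₁ c₂ : ℝ} (hαβ : α < β) (h1 : 0 < c₁)
    (h2 : 0 ≤ c₂) :
    ∃ κ K : ℝ, 0 < κ ∧ κ ≤ 1 ∧ 0 < K ∧ ∀ f g : ℝ → ℝ,
      QuadraticallyConvexOn (Set.Icc α β) c₁ c₂ f g → ∀ C σ : ℝ, 1 / 2 ≤ C → 0 ≤ σ → σ ≤ κ →
      ∀ (V : Finset (ℤ × ℤ × ℤ)) (ξ : ℤ × ℤ × ℤ → ℝ), (∀ v ∈ V, IsPrimitiveTriple v) →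
      (∀ v ∈ V, NearTangent f g (Set.Icc α β) C σ v (ξ v)) →
      (V.card : ℝ) ≤ K * (C + σ * C * √C) := by
  classical
  set η : ℝ := 1 / (100 * (1 + c₂)) with hηdef
  have hη0 : 0 < η := by positivity
  have hη : 100 * (1 + c₂) * η ≤ 1 := by rw [hηdef]; field_simp; rfl
  have hη1 : η ≤ 1 := by nlinarith
  have hA : 0 < 4 / c₁ + 2 := by positivity
  have hA1 : 1 ≤ 4 / c₁ + 2 := by
    have : 0 < 4 / c₁ := by positivity
    linarith
  set K₁ := (β - α) / η + 2 with hK₁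
  set K₂ := 8 * (2 + c₂ * (4 / c₁ + 2)) with hK₂
  set K₃ := 4 * (β - α + 3) with hK₃
  have hba : 0 < β - α := sub_pos.mpr hαβ
  have hK₁0 : 0 < K₁ := by positivity
  have hK₂0 : 0 < K₂ := by positivity
  have hK₃0 : 0 < K₃ := by positivity
  -- This `κ` brings contact points of concurrent lines, on one side, within a cell length. In the
  -- constant, `2 * K₁` allows two lines per cell and the rest comes from the sum of `1 / q`.
  refine ⟨η / (4 / c₁ + 2), 2 * K₁ + K₂ * (K₃ + K₁), by positivity,
    (div_le_one hA).mpr (hη1.trans hA1), by positivity, ?_⟩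
  intro f g hf C σ hC2 hσ hσκ V ξ hprim hV
  have hC : 0 < C := by linarith
  have hση' : (4 / c₁ + 2) * σ ≤ η := by rwa [le_div_iff₀' hA] at hσκ
  have hση : σ ≤ η := le_trans (by nlinarith) hση'
  let cell : ℤ × ℤ × ℤ → ℕ := fun v => ⌊(ξ v - α) * C / η⌋₊
  have hcell : ∀ u ∈ V, ∀ v ∈ V, cell u = cell v → |ξ v - ξ u| ≤ η / C := by
    intro u hu v hv h
    have pu : 0 ≤ (ξ u - α) * C / η :=
      div_nonneg (mul_nonneg (sub_nonneg.mpr (hV u hu).mem.1) hC.le) hη0.le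
    have pv : 0 ≤ (ξ v - α) * C / η :=
      div_nonneg (mul_nonneg (sub_nonneg.mpr (hV v hv).mem.1) hC.le) hη0.le
    have a := Nat.floor_le pu
    have b := Nat.lt_floor_add_one ((ξ u - α) * C / η)
    have a' := Nat.floor_le pv
    have b' := Nat.lt_floor_add_one ((ξ v - α) * C / η)
    change ⌊(ξ u - α) * C / η⌋₊ = ⌊(ξ v - α) * C / η⌋₊ at h
    rw [h] at a b
    have e : ξ v - ξ u = ((ξ v - α) * C / η - (ξ u - α) * C / η) * (η / C) := by field_simp; ring
    rw [e, abs_mul, abs_of_pos (by positivity : 0 < η / C)]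
    refine mul_le_of_le_one_left (by positivity) ?_
    rw [abs_le]; constructor <;> linarith
  set cells := V.image cell
  let fib : ℕ → Finset (ℤ × ℤ × ℤ) := fun J => V.filter fun v => cell v = J
  set big := cells.filter fun J => 1 < (fib J).card
  -- To each cell with at least two lines is attached one of its lines and the primitive vector of
  -- the common point; other cells get a dummy value.
  have hbig : ∀ J : ℕ, ∃ vw : (ℤ × ℤ × ℤ) × (ℤ × ℤ × ℤ), J ∈ big → vw.1 ∈ fib J ∧
      IsPrimitiveTriple vw.2 ∧ 0 < vw.2.1 ∧ (∀ z ∈ fib J, tripleDot z vw.2 = 0) ∧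
      (vw.2.1 : ℝ) ≤ C ∧
      |ξ vw.1 - vw.2.2.1 / vw.2.1| ≤ 8 * (2 + c₂) * η ^ 2 / vw.2.1 := by
    intro J
    by_cases hJ : J ∈ big
    swap
    · exact ⟨0, fun h => absurd h hJ⟩
    obtain ⟨u, hu, v, hv, huv⟩ := Finset.one_lt_card.mp (Finset.mem_filter.mp hJ).2
    obtain ⟨uV, cu⟩ := Finset.mem_filter.mp hu
    obtain ⟨vV, cv⟩ := Finset.mem_filter.mp hv
    have nu := hV u uV
    have nv := hV v vV
    have huv' := hcell u uV v vV (cu.trans cv.symm)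
    have hm : u.2.1 * v.2.2 - v.2.1 * u.2.2 ≠ 0 := by
      intro h
      refine huv ((hprim u uV).eq_of_proportional (hprim v vV)
        (by exact_mod_cast nu.last_pos hC) (by exact_mod_cast nv.last_pos hC)
        (nu.proportional_of_minor_eq_zero hf h1.le h2 hC hσ hση hη nv huv' h) (by linarith))
    obtain ⟨w, hw1, hw, hwz⟩ := exists_primitive_normal u v hm
    have hz : ∀ z ∈ fib J, tripleDot z w = 0 := by
      intro z hz
      obtain ⟨zV, cz⟩ := Finset.mem_filter.mp hz
      exact hwz z (nu.tripleDet_eq_zero hf h1.le h2 hC hσ hση hη nv (hV z zV) huv'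
        (hcell u uV z zV (cu.trans cz.symm)))
    have hle := le_abs_minor_of_concurrent hw1 (hz u hu) (hz v hv) hm
    refine ⟨(u, w), fun _ => ⟨hu, hw1, hw, hz, ?_, ?_⟩⟩
    · exact hle.trans (nu.abs_minor_le hf h1.le h2 hC hσ hση hη nv huv')
    · exact nu.abs_sub_concurrence_le hf h1.le h2 hC hσ hση nv
        (concurrent_of_tripleDot_eq_zero hw (hz u hu))
        (concurrent_of_tripleDot_eq_zero hw (hz v hv)) huv' (by exact_mod_cast hw) hle
  choose vw hvw using hbig
  have hcells : (cells.card : ℝ) ≤ K₁ * C := by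
    have hsub : cells ⊆ Finset.range (⌊(β - α) * C / η⌋₊ + 1) := by
      intro J hJ
      obtain ⟨v, hv, rfl⟩ := Finset.mem_image.mp hJ
      rw [Finset.mem_range, Nat.lt_succ_iff]
      refine Nat.floor_le_floor ?_
      have := (hV v hv).mem.2
      gcongr
    have hc := Finset.card_le_card hsub
    rw [Finset.card_range] at hc
    have hc' : (cells.card : ℝ) ≤ ⌊(β - α) * C / η⌋₊ + 1 := by exact_mod_cast hc
    have hfl := Nat.floor_le (a := (β - α) * C / η) (by positivity)
    calc _ ≤ (β - α) * C / η + 1 := by linarith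
      _ ≤ (β - α) * C / η + 2 * C := by linarith
      _ = K₁ * C := by rw [hK₁]; ring
  have hfibcard : ∀ J ∈ big, ((fib J).card : ℝ) ≤ 2 + K₂ * σ * C * (1 / ((vw J).2.1.toNat : ℝ)) := by
    intro J hJ
    obtain ⟨-, hw1, hw, hz, -, -⟩ := hvw J hJ
    have := card_concurrent_le hf h1 h2 hC hσ (fib J) ξ
      (fun v hv => hprim v (Finset.mem_filter.mp hv).1)
      (fun v hv => hV v (Finset.mem_filter.mp hv).1) hw1 hw hz
    have e : (((vw J).2.1.toNat : ℕ) : ℝ) = ((vw J).2.1 : ℝ) := by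
      rw [← Int.cast_natCast, Int.toNat_of_nonneg hw.le]
    rwa [e]
  have hlev := card_cells_le hαβ hf h1 h2 hC hσ hη0 hη hση' big (fun J => (vw J).1)
    (fun J => (vw J).2) (fun J => ξ (vw J).1)
    (fun J hJ => (Finset.mem_filter.mp (hvw J hJ).1).2.symm) (fun J hJ => (hvw J hJ).2.2.1)
    (fun J hJ => hV _ (Finset.mem_filter.mp (hvw J hJ).1).1)
    (fun J hJ => (hvw J hJ).2.2.2.1 _ (hvw J hJ).1) (fun J hJ => (hvw J hJ).2.2.2.2.1)
    (fun J hJ => (hvw J hJ).2.2.2.2.2)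
  have hsC : 0 < √C := Real.sqrt_pos.mpr hC
  have hsq : √C * √C = C := Real.mul_self_sqrt hC.le
  -- The cut-off `√C` balances `K₃ R` against `K₁ C / R`.
  have hinv : ∑ J ∈ big, (1 / ((vw J).2.1.toNat : ℝ)) ≤ (K₃ + K₁) * √C := by
    have hb := sum_inv_le_of_card_level_le big (fun J => (vw J).2.1.toNat) hK₃0.le hsC
      (fun J hJ => by have := (hvw J hJ).2.2.1; omega) hlev
    refine hb.trans ?_
    have hbc : (big.card : ℝ) ≤ K₁ * C :=
      le_trans (by exact_mod_cast Finset.card_le_card (Finset.filter_subset _ _)) hcells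
    have : (big.card : ℝ) / √C ≤ K₁ * √C := by
      rw [div_le_iff₀ hsC, mul_assoc, hsq]; exact hbc
    linarith
  have hsum : (V.card : ℝ) = ∑ J ∈ cells, ((fib J).card : ℝ) := by
    rw [Finset.card_eq_sum_card_image cell V]; push_cast; rfl
  have hsplit : ∑ J ∈ cells, ((fib J).card : ℝ) ≤ ∑ J ∈ cells, (2 : ℝ)
      + ∑ J ∈ big, K₂ * σ * C * (1 / ((vw J).2.1.toNat : ℝ)) := by
    rw [Finset.sum_filter, ← Finset.sum_add_distrib]
    refine Finset.sum_le_sum fun J hJ => ?_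
    split_ifs with h
    · exact hfibcard J (Finset.mem_filter.mpr ⟨hJ, h⟩)
    · have : ((fib J).card : ℝ) ≤ 1 := by exact_mod_cast not_lt.mp h
      linarith
  rw [hsum]
  refine hsplit.trans ?_
  rw [← Finset.mul_sum, Finset.sum_const, nsmul_eq_mul]
  have hm := mul_le_mul_of_nonneg_left hinv (by positivity : 0 ≤ K₂ * σ * C)
  have t1 : 0 ≤ K₁ * (σ * C * √C) := by positivity
  have t2 : 0 ≤ K₂ * (K₃ + K₁) * C := by positivity
  linarith

/-- Passing to the primitive part divides the form and the slope defect by `d`, whereas at height `C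
/ d` the tolerance for the form only grows and that for the slope is unchanged. -/
theorem NearTangent.of_smul {f g : ℝ → ℝ} {I : Set ℝ} {C σ : ℝ} {v w : ℤ × ℤ × ℤ} {x : ℝ} {d : ℕ}
    (hC : 0 < C) (hd : 0 < d) (h : NearTangent f g I C σ v x) (h1 : v.1 = d * w.1)
    (h2 : v.2.1 = d * w.2.1) (h3 : v.2.2 = d * w.2.2) : NearTangent f g I (C / d) σ w x := by
  have hd0 : (0 : ℝ) < d := by exact_mod_cast hd
  have hd1 : (1 : ℝ) ≤ d := by exact_mod_cast hd
  have e3 : (v.2.2 : ℝ) = d * w.2.2 := by rw [h3]; push_cast; rfl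
  have eF : dualForm f v x = d * dualForm f w x := by
    simp only [dualForm, h1, h2, h3]; push_cast; ring
  have eS : dualSlope g v x = d * dualSlope g w x := by
    simp only [dualSlope, h2, h3]; push_cast; ring
  have hF := h.form
  have hS := h.slope
  rw [eF, abs_mul, abs_of_pos hd0] at hF
  rw [eS, abs_mul, abs_of_pos hd0] at hS
  refine ⟨h.mem, ?_, ?_, ?_, ?_⟩
  · rw [div_le_iff₀ hd0, mul_comm, ← e3]; exact h.le
  · rw [← mul_div_assoc, lt_div_iff₀ hd0, mul_comm, ← e3]; exact h.lt
  · calc |dualForm f w x| ≤ d * |dualForm f w x| := le_mul_of_one_le_left (abs_nonneg _) hd1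
      _ ≤ σ ^ 2 / C := hF
      _ ≤ σ ^ 2 / (C / d) := by
        gcongr
        exact div_le_self hC.le hd1
  · exact (le_mul_of_one_le_left (abs_nonneg _) hd1).trans hS

/-- The number of lines of height about `C` nearly tangent to the graph of `f`. -/
theorem exists_card_nearTangent_le {α β c₁ c₂ : ℝ} (hαβ : α < β) (h1 : 0 < c₁) (h2 : 0 ≤ c₂) :
    ∃ κ K : ℝ, 0 < κ ∧ κ ≤ 1 ∧ 0 < K ∧ ∀ f g : ℝ → ℝ,
      QuadraticallyConvexOn (Set.Icc α β) c₁ c₂ f g → ∀ C σ : ℝ, 1 ≤ C → 0 ≤ σ → σ ≤ κ →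
      ∀ (V : Finset (ℤ × ℤ × ℤ)) (ξ : ℤ × ℤ × ℤ → ℝ),
      (∀ v ∈ V, NearTangent f g (Set.Icc α β) C σ v (ξ v)) →
      (V.card : ℝ) ≤ K * (C * √√C + σ * C * √C) := by
  classical
  obtain ⟨κ, K, hκ, hκ1, hK, hmain⟩ := exists_card_primitive_nearTangent_le hαβ h1 h2
  -- Summing `C / d` over the contents `d` would cost a logarithm. As `d ≤ 2C`, a factor `C^(1/4)`
  -- buys the convergent exponent `5/4`; this loss is harmless later.
  have hsum : Summable fun k : ℕ => 1 / (k : ℝ) ^ (5 / 4 : ℝ) :=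
    Real.summable_one_div_nat_rpow.mpr (by norm_num)
  set S := ∑' k : ℕ, 1 / (k : ℝ) ^ (5 / 4 : ℝ) with hS
  have hS0 : 0 ≤ S := tsum_nonneg fun k => by positivity
  refine ⟨κ, 2 * K * (S + 1), hκ, hκ1, by positivity, ?_⟩
  intro f g hf C σ hC1 hσ hσκ V ξ hV
  have hC : 0 < C := by linarith
  have hdec : ∀ v : ℤ × ℤ × ℤ, ∃ dw : ℕ × (ℤ × ℤ × ℤ), v ∈ V → 0 < dw.1 ∧
      IsPrimitiveTriple dw.2 ∧ v.1 = dw.1 * dw.2.1 ∧ v.2.1 = dw.1 * dw.2.2.1 ∧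
      v.2.2 = dw.1 * dw.2.2.2 := by
    intro v
    by_cases hv : v ∈ V
    · have hv0 : v ≠ 0 := by
        rintro rfl
        have := (hV 0 hv).last_pos hC
        simp at this
      obtain ⟨d, w, h⟩ := exists_primitive_smul v hv0
      exact ⟨(d, w), fun _ => h⟩
    · exact ⟨0, fun h => absurd h hv⟩
  choose dw hdw using hdec
  have hk : ∀ v ∈ V, NearTangent f g (Set.Icc α β) (C / (dw v).1) σ (dw v).2 (ξ v) := fun v hv =>
    (hV v hv).of_smul hC (hdw v hv).1 (hdw v hv).2.2.1 (hdw v hv).2.2.2.1 (hdw v hv).2.2.2.2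
  -- The last entry of the primitive part is a positive integer below `2C / d`.
  have hhalf : ∀ v ∈ V, 1 / 2 ≤ C / (dw v).1 := by
    intro v hv
    have hn := hk v hv
    have hd : (0 : ℝ) < (dw v).1 := by exact_mod_cast (hdw v hv).1
    have hp := hn.last_pos (by positivity)
    have hp' : 0 < (dw v).2.2.2 := by exact_mod_cast hp
    have : (1 : ℝ) ≤ (dw v).2.2.2 := by exact_mod_cast hp'
    linarith [hn.lt]
  have hfib : ∀ k ∈ V.image fun v => (dw v).1,
      ((V.filter fun v => (dw v).1 = k).card : ℝ) ≤
        2 * K * (C * √√C + σ * C * √C) * (1 / (k : ℝ) ^ (5 / 4 : ℝ)) := by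
    intro k hkim
    obtain ⟨v0, hv0, hk0⟩ := Finset.mem_image.mp hkim
    have hkpos : 0 < k := by rw [← hk0]; exact (hdw v0 hv0).1
    have hkR : (0 : ℝ) < k := by exact_mod_cast hkpos
    have hk1 : (1 : ℝ) ≤ k := by exact_mod_cast hkpos
    have hCk : 1 / 2 ≤ C / k := by rw [← hk0]; exact hhalf v0 hv0
    have hinj : Set.InjOn (fun v => (dw v).2) (V.filter fun v => (dw v).1 = k) := by
      intro u hu v hv huv
      obtain ⟨uV, uk⟩ := Finset.mem_filter.mp hu
      obtain ⟨vV, vk⟩ := Finset.mem_filter.mp hv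
      obtain ⟨-, -, a1, a2, a3⟩ := hdw u uV
      obtain ⟨-, -, b1, b2, b3⟩ := hdw v vV
      simp only at huv
      rw [uk, huv] at a1 a2 a3
      rw [vk] at b1 b2 b3
      exact Prod.ext (a1.trans b1.symm) (Prod.ext (a2.trans b2.symm) (a3.trans b3.symm))
    set W := (V.filter fun v => (dw v).1 = k).image fun v => (dw v).2
    have hWex : ∀ w : ℤ × ℤ × ℤ, ∃ x : ℝ, w ∈ W → IsPrimitiveTriple w ∧
        NearTangent f g (Set.Icc α β) (C / k) σ w x := by
      intro w
      by_cases hw : w ∈ W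
      · obtain ⟨v, hv, rfl⟩ := Finset.mem_image.mp hw
        obtain ⟨vV, vk⟩ := Finset.mem_filter.mp hv
        refine ⟨ξ v, fun _ => ⟨(hdw v vV).2.1, ?_⟩⟩
        have := hk v vV
        rwa [vk] at this
      · exact ⟨0, fun h => absurd h hw⟩
    choose ζ hζ using hWex
    have hb := hmain f g hf (C / k) σ hCk hσ hσκ W ζ (fun w hw => (hζ w hw).1)
      (fun w hw => (hζ w hw).2)
    rw [Finset.card_image_of_injOn hinj] at hb
    -- Only `k ≤ 2C` is at hand to use; 16 is taken because its fourth root is 2.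
    have hk2C : (k : ℝ) ≤ 16 * C := by
      rw [le_div_iff₀ hkR] at hCk; linarith
    have hquart : √√(k : ℝ) = (k : ℝ) ^ (1 / 4 : ℝ) := by
      rw [Real.sqrt_eq_rpow, Real.sqrt_eq_rpow, ← Real.rpow_mul hkR.le]; norm_num
    have hk54 : (k : ℝ) ^ (5 / 4 : ℝ) = k * √√(k : ℝ) := by
      rw [hquart, ← Real.rpow_one_add' hkR.le (by norm_num)]; norm_num
    have hsk : 0 < √√(k : ℝ) := by positivity
    have hsk2 : √√(k : ℝ) ≤ 2 * √√C := by
      have e : (2 : ℝ) = √√16 := by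
        rw [show (16 : ℝ) = 4 ^ 2 by norm_num, Real.sqrt_sq (by norm_num),
          show (4 : ℝ) = 2 ^ 2 by norm_num, Real.sqrt_sq (by norm_num)]
      rw [e, ← Real.sqrt_mul (by positivity), ← Real.sqrt_mul (by positivity)]
      exact Real.sqrt_le_sqrt (Real.sqrt_le_sqrt hk2C)
    have hsk3 : √√(k : ℝ) ≤ √(k : ℝ) := by
      refine Real.sqrt_le_sqrt ?_
      exact (Real.sqrt_le_left hkR.le).mpr (by nlinarith)
    refine hb.trans ?_
    have t1 : C / k ≤ 2 * (C * √√C) * (1 / (k : ℝ) ^ (5 / 4 : ℝ)) := by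
      rw [hk54]
      calc C / k = C * √√(k : ℝ) / (k * √√(k : ℝ)) := by field_simp
        _ ≤ C * (2 * √√C) / (k * √√(k : ℝ)) := by gcongr
        _ = _ := by ring
    have t2 : σ * (C / k) * √(C / k) ≤ 2 * (σ * C * √C) * (1 / (k : ℝ) ^ (5 / 4 : ℝ)) := by
      rw [hk54, Real.sqrt_div hC.le]
      calc σ * (C / k) * (√C / √k) = σ * C * √C / (k * √k) := by ring
        _ ≤ σ * C * √C / (k * √√k) := by gcongr
        _ ≤ 2 * (σ * C * √C) / (k * √√k) :=
          div_le_div_of_nonneg_right (le_mul_of_one_le_left (by positivity) one_le_two)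
            (by positivity)
        _ = _ := by ring
    calc _ ≤ K * (2 * (C * √√C) * (1 / (k : ℝ) ^ (5 / 4 : ℝ))
          + 2 * (σ * C * √C) * (1 / (k : ℝ) ^ (5 / 4 : ℝ))) := by gcongr
      _ = _ := by ring
  have hcard : (V.card : ℝ) = ∑ k ∈ V.image fun v => (dw v).1,
      ((V.filter fun v => (dw v).1 = k).card : ℝ) := by
    rw [Finset.card_eq_sum_card_image (fun v => (dw v).1) V]; push_cast; rfl
  rw [hcard]
  refine (Finset.sum_le_sum hfib).trans ?_
  rw [← Finset.mul_sum]
  have hle : ∑ k ∈ V.image fun v => (dw v).1, 1 / (k : ℝ) ^ (5 / 4 : ℝ) ≤ S + 1 :=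
    (hsum.sum_le_tsum _ fun k _ => by positivity).trans (by linarith)
  calc _ ≤ 2 * K * (C * √√C + σ * C * √C) * (S + 1) := by gcongr
    _ = _ := by ring

/-! ### Incidences between grid points and lines -/

theorem sum_range_pow_le {t : ℝ} (ht : 1 < t) (J : ℕ) :
    ∑ j ∈ Finset.range (J + 1), t ^ j ≤ t / (t - 1) * t ^ J := by
  have h : 0 < t - 1 := by linarith
  rw [geom_sum_eq ht.ne', div_mul_eq_mul_div, div_le_div_iff_of_pos_right h, pow_succ]
  linarith

/-- The number of incidences between the points of a grid and the lines nearly tangent there. -/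
theorem exists_card_incidences_le {α β c₁ c₂ : ℝ} (hαβ : α < β) (h1 : 0 < c₁) (h2 : 0 ≤ c₂) :
    ∃ κ K : ℝ, 0 < κ ∧ κ ≤ 1 ∧ 0 < K ∧ ∀ f g : ℝ → ℝ,
      QuadraticallyConvexOn (Set.Icc α β) c₁ c₂ f g → ∀ H σ : ℝ, 0 < H → 0 < σ → σ ≤ κ →
      σ ^ 2 * √H ≤ 1 → ∀ P : Finset ((ℤ × ℤ × ℤ) × ℕ),
      (∀ p ∈ P, α + p.2 * (σ / H) ∈ Set.Icc α β ∧ 0 < p.1.2.2 ∧ (p.1.2.2 : ℝ) ≤ H ∧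
        |dualForm f p.1 (α + p.2 * (σ / H))| ≤ σ ^ 2 / H ∧
        |dualSlope g p.1 (α + p.2 * (σ / H))| ≤ σ) →
      (P.card : ℝ) ≤ K * (H / σ) := by
  classical
  obtain ⟨κ, K, hκ, hκ1, hK, hmain⟩ := exists_card_nearTangent_le hαβ h1 h2
  set t := √√(2 : ℝ) with ht
  set r := √(2 : ℝ) with hr
  have hr1 : 1 < r := by rw [hr]; exact Real.lt_sqrt_of_sq_lt (by norm_num)
  have ht1 : 1 < t := by rw [ht]; exact Real.lt_sqrt_of_sq_lt (by simpa using hr1)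
  have ht0 : 0 < t / (t - 1) := div_pos (by linarith) (by linarith)
  have hr0 : 0 < r / (r - 1) := div_pos (by linarith) (by linarith)
  refine ⟨κ, (1 + 2 / c₁) * K * (t / (t - 1) + r / (r - 1)), hκ, hκ1, by positivity, ?_⟩
  intro f g hf H σ hH hσ hσκ hσH P hP
  rcases P.eq_empty_or_nonempty with rfl | ⟨p0, hp0⟩
  · simp; positivity
  have hH1 : 1 ≤ H := by
    obtain ⟨-, a, b, -⟩ := hP p0 hp0
    have : (1 : ℝ) ≤ p0.1.2.2 := by exact_mod_cast a
    linarith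
  set J := Nat.log 2 ⌊H⌋₊
  let lev : (ℤ × ℤ × ℤ) × ℕ → ℕ := fun p => Nat.log 2 p.1.2.2.toNat
  have hnat : ∀ p ∈ P, p.1.2.2.toNat ≠ 0 ∧ ((p.1.2.2.toNat : ℕ) : ℝ) = p.1.2.2 := by
    intro p hp
    obtain ⟨-, a, -⟩ := hP p hp
    refine ⟨by omega, ?_⟩
    rw [← Int.cast_natCast, Int.toNat_of_nonneg a.le]
  have hlev : ∀ p ∈ P, (2 : ℝ) ^ lev p ≤ p.1.2.2 ∧ (p.1.2.2 : ℝ) < 2 * 2 ^ lev p := by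
    intro p hp
    obtain ⟨a, b⟩ := hnat p hp
    have h1 := Nat.pow_log_le_self 2 a
    have h2 := Nat.lt_pow_succ_log_self (b := 2) (by norm_num) p.1.2.2.toNat
    rw [← b]
    constructor
    · exact_mod_cast h1
    · rw [pow_succ, mul_comm] at h2; exact_mod_cast h2
  have hJ : (2 : ℝ) ^ J ≤ H := by
    have h1 := Nat.pow_log_le_self 2 (x := ⌊H⌋₊) (Nat.floor_pos.mpr hH1).ne'
    have h2 : ((2 ^ J : ℕ) : ℝ) ≤ ⌊H⌋₊ := by exact_mod_cast h1
    push_cast at h2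
    exact h2.trans (Nat.floor_le hH.le)
  have hmaps : ∀ p ∈ P, lev p ∈ Finset.range (J + 1) := by
    intro p hp
    rw [Finset.mem_range, Nat.lt_succ_iff]
    refine Nat.log_mono_right (Nat.le_floor ?_)
    rw [(hnat p hp).2]
    exact (hP p hp).2.2.1
  -- Since `g` increases at rate at least `c₁`, the slope condition confines the contact points to a
  -- span of `2σ / (c₁ 2^j)`, to be compared with the grid spacing `σ / H`.
  have hfibx : ∀ v j, ((((P.filter fun p => lev p = j).filter fun p => p.1 = v)).card : ℝ)
      ≤ (1 + 2 / c₁) * (H / 2 ^ j) := by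
    intro v j
    set F := (P.filter fun p => lev p = j).filter fun p => p.1 = v
    rcases F.eq_empty_or_nonempty with h | ⟨p1, hp1⟩
    · rw [h]; simp; positivity
    have hF : ∀ p ∈ F, p ∈ P ∧ lev p = j ∧ p.1 = v := fun p hp =>
      ⟨(Finset.mem_filter.mp (Finset.mem_filter.mp hp).1).1,
        (Finset.mem_filter.mp (Finset.mem_filter.mp hp).1).2, (Finset.mem_filter.mp hp).2⟩
    have hjc : (2 : ℝ) ^ j ≤ v.2.2 := by
      have := (hlev p1 (hF p1 hp1).1).1
      rwa [(hF p1 hp1).2.1, (hF p1 hp1).2.2] at this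
    have hjH : (2 : ℝ) ^ j ≤ H := by
      have := (hP p1 (hF p1 hp1).1).2.2.1
      rw [(hF p1 hp1).2.2] at this
      exact hjc.trans this
    have h2j : (0 : ℝ) < 2 ^ j := by positivity
    have hvc : (0 : ℝ) < v.2.2 := h2j.trans_le hjc
    have := card_le_of_separated F (fun p => (p.2 : ℝ)) (h := 1) (D := 2 / c₁ * (H / 2 ^ j))
      one_pos (by positivity) ?_ ?_
    · have h3 : 1 ≤ H / 2 ^ j := (one_le_div h2j).mpr hjH
      rw [div_one] at this
      linarith
    · intro p hp q hq hpq
      have hne : p.2 ≠ q.2 := fun h =>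
        hpq (Prod.ext ((hF p hp).2.2.trans (hF q hq).2.2.symm) h)
      have : (p.2 : ℤ) - q.2 ≠ 0 := by omega
      have := Int.one_le_abs this
      exact_mod_cast this
    · intro p hp q hq
      obtain ⟨mp, -, -, -, sp⟩ := hP p (hF p hp).1
      obtain ⟨mq, -, -, -, sq⟩ := hP q (hF q hq).1
      rw [(hF p hp).2.2] at sp
      rw [(hF q hq).2.2] at sq
      have hg := hf.le_abs_slope_sub mp mq
      have e : v.2.2 * (g (α + p.2 * (σ / H)) - g (α + q.2 * (σ / H)))
          = dualSlope g v (α + p.2 * (σ / H)) - dualSlope g v (α + q.2 * (σ / H)) := by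
        simp only [dualSlope]; ring
      have hb := (abs_sub _ _).trans (add_le_add sp sq)
      rw [← e, abs_mul, abs_of_pos hvc] at hb
      have e2 : α + p.2 * (σ / H) - (α + q.2 * (σ / H)) = ((p.2 : ℝ) - q.2) * (σ / H) := by ring
      rw [e2, abs_mul, abs_of_pos (by positivity : 0 < σ / H)] at hg
      have h3 : 2 ^ j * (c₁ * (|(p.2 : ℝ) - q.2| * (σ / H))) ≤ σ + σ :=
        (mul_le_mul hjc hg (by positivity) hvc.le).trans hb
      have e3 : |(p.2 : ℝ) - q.2|
          = 2 ^ j * (c₁ * (|(p.2 : ℝ) - q.2| * (σ / H))) * (H / (2 ^ j * c₁ * σ)) := by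
        field_simp
      rw [e3]
      calc _ ≤ (σ + σ) * (H / (2 ^ j * c₁ * σ)) := by gcongr
        _ = _ := by field_simp; ring
  have hlevcard : ∀ j, ((P.filter fun p => lev p = j).card : ℝ) ≤
      (1 + 2 / c₁) * K * H * (t ^ j + σ * r ^ j) := by
    intro j
    have h2j : (0 : ℝ) < 2 ^ j := by positivity
    set F := P.filter fun p => lev p = j
    set V := F.image Prod.fst
    have hVex : ∀ v : ℤ × ℤ × ℤ, ∃ x : ℝ, v ∈ V →
        NearTangent f g (Set.Icc α β) (2 ^ j) σ v x := by
      intro v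
      by_cases hv : v ∈ V
      · obtain ⟨p, hp, rfl⟩ := Finset.mem_image.mp hv
        obtain ⟨pP, pj⟩ := Finset.mem_filter.mp hp
        obtain ⟨a, b, c, d, e⟩ := hP p pP
        have hl := hlev p pP
        rw [pj] at hl
        refine ⟨α + p.2 * (σ / H), fun _ => ⟨a, hl.1, hl.2, d.trans ?_, e⟩⟩
        have := hl.1.trans c
        gcongr
      · exact ⟨0, fun h => absurd h hv⟩
    choose ξ hξ using hVex
    have hVcard := hmain f g hf (2 ^ j) σ (one_le_pow₀ (by norm_num)) hσ.le hσκ V ξ hξ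
    have et : √√((2 : ℝ) ^ j) = t ^ j := by
      rw [Real.sqrt_eq_iff_mul_self_eq_of_pos (by positivity), ← mul_pow, ht,
        Real.mul_self_sqrt (by positivity)]
      symm
      rw [Real.sqrt_eq_iff_mul_self_eq_of_pos (by positivity), ← mul_pow,
        Real.mul_self_sqrt (by positivity)]
    have er : √((2 : ℝ) ^ j) = r ^ j := by
      rw [Real.sqrt_eq_iff_mul_self_eq_of_pos (by positivity), ← mul_pow, hr,
        Real.mul_self_sqrt (by positivity)]
    rw [et, er] at hVcard
    have hF : (F.card : ℝ) = ∑ v ∈ V, ((F.filter fun p => p.1 = v).card : ℝ) := by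
      rw [Finset.card_eq_sum_card_image Prod.fst F]; push_cast; rfl
    rw [hF]
    calc _ ≤ ∑ v ∈ V, (1 + 2 / c₁) * (H / 2 ^ j) := Finset.sum_le_sum fun v _ => hfibx v j
      _ = V.card * ((1 + 2 / c₁) * (H / 2 ^ j)) := by rw [Finset.sum_const, nsmul_eq_mul]
      _ ≤ K * (2 ^ j * t ^ j + σ * 2 ^ j * r ^ j) * ((1 + 2 / c₁) * (H / 2 ^ j)) := by gcongr
      _ = _ := by field_simp
  have hσ1 : σ ≤ 1 := hσκ.trans hκ1
  -- The geometric sums are governed by the top height `2^J ≤ H`, with terms at most `H^(1/4)` and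
  -- `σ√H`; `σ²√H ≤ 1` bounds both by `1 / σ`.
  have htJ : t ^ J ≤ 1 / σ := by
    rw [le_div_iff₀ hσ]
    have h4 : (t ^ J) ^ 4 ≤ H := by
      have : t ^ 4 = 2 := by
        rw [show 4 = 2 * 2 from rfl, pow_mul, ht, Real.sq_sqrt (by positivity),
          Real.sq_sqrt (by norm_num)]
      rw [← pow_mul, mul_comm, pow_mul, this]; exact hJ
    have h5 : (t ^ J) ^ 2 ≤ √H := Real.le_sqrt_of_sq_le (by rw [← pow_mul]; exact h4)
    have h6 : (t ^ J * σ) ^ 2 ≤ 1 := by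
      rw [mul_pow]
      calc _ ≤ √H * σ ^ 2 := by gcongr
        _ ≤ 1 := by linarith
    exact (sq_le_one_iff₀ (by positivity)).mp h6
  have hrJ : σ * r ^ J ≤ 1 / σ := by
    rw [le_div_iff₀ hσ]
    have h5 : r ^ J ≤ √H := Real.le_sqrt_of_sq_le (by
      rw [← pow_mul, mul_comm, pow_mul, hr, Real.sq_sqrt (by norm_num)]; exact hJ)
    calc σ * r ^ J * σ = σ ^ 2 * r ^ J := by ring
      _ ≤ σ ^ 2 * √H := by gcongr
      _ ≤ 1 := hσH
  have hPcard : (P.card : ℝ) = ∑ j ∈ Finset.range (J + 1),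
      ((P.filter fun p => lev p = j).card : ℝ) := by
    rw [Finset.card_eq_sum_card_fiberwise hmaps]; push_cast; rfl
  rw [hPcard]
  calc _ ≤ ∑ j ∈ Finset.range (J + 1), (1 + 2 / c₁) * K * H * (t ^ j + σ * r ^ j) :=
        Finset.sum_le_sum fun j _ => hlevcard j
    _ = (1 + 2 / c₁) * K * H * (∑ j ∈ Finset.range (J + 1), t ^ j
        + σ * ∑ j ∈ Finset.range (J + 1), r ^ j) := by
      rw [← Finset.mul_sum, Finset.sum_add_distrib, Finset.mul_sum]
    _ ≤ (1 + 2 / c₁) * K * H * (t / (t - 1) * t ^ J + σ * (r / (r - 1) * r ^ J)) := by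
      gcongr
      · exact sum_range_pow_le ht1 J
      · exact sum_range_pow_le hr1 J
    _ = (1 + 2 / c₁) * K * H * (t / (t - 1) * t ^ J + r / (r - 1) * (σ * r ^ J)) := by ring
    _ ≤ (1 + 2 / c₁) * K * H * (t / (t - 1) * (1 / σ) + r / (r - 1) * (1 / σ)) := by gcongr
    _ = _ := by ring

/-! ### From arcs of the curve to dual boxes -/

theorem finite_dual_box (x0 y0 z0 r1 r2 r3 : ℝ) :
    {m : ℤ × ℤ × ℤ | |(m.2.2 : ℝ)| ≤ r3 ∧ |(m.2.1 : ℝ) + z0 * m.2.2| ≤ r2 ∧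
      |(m.1 : ℝ) + (x0 * m.2.1 + y0 * m.2.2)| ≤ r1}.Finite := by
  have hball : ∀ r : ℝ, {n : ℤ | |(n : ℝ)| ≤ r}.Finite := by
    intro r
    refine (Set.finite_Icc (-⌈r⌉) ⌈r⌉).subset fun n hn => ?_
    have h := abs_le.mp (show |(n : ℝ)| ≤ r from hn)
    have h1 := Int.le_ceil r
    constructor
    · have : (-⌈r⌉ : ℝ) ≤ n := by linarith [h.1]
      exact_mod_cast this
    · have : (n : ℝ) ≤ ⌈r⌉ := by linarith [h.2]
      exact_mod_cast this
  refine ((hball (r1 + |x0| * (r2 + |z0| * r3) + |y0| * r3)).prod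
    ((hball (r2 + |z0| * r3)).prod (hball r3))).subset ?_
  rintro ⟨a, b, c⟩ ⟨hc, hb, ha⟩
  simp only at ha hb hc
  have hb' : |(b : ℝ)| ≤ r2 + |z0| * r3 := by
    have e : (b : ℝ) = (b + z0 * c) - z0 * c := by ring
    rw [e]
    exact (abs_sub _ _).trans (add_le_add hb (abs_mul_le_mul le_rfl hc))
  refine ⟨?_, hb', hc⟩
  have e : (a : ℝ) = (a + (x0 * b + y0 * c)) - x0 * b - y0 * c := by ring
  change |(a : ℝ)| ≤ _
  rw [e]
  exact (abs_sub _ _).trans (add_le_add ((abs_sub _ _).trans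
    (add_le_add ha (abs_mul_le_mul le_rfl hb'))) (abs_mul_le_mul le_rfl hc))

/-- A dual box that is thin in two directions is determined, up to sign, by its points with positive
last entry. -/
theorem card_dual_box_le (x0 y0 z0 r1 r2 r3 : ℝ) (h1 : r1 < 1) (h2 : r2 < 1)
    (B : Finset (ℤ × ℤ × ℤ)) (hB : ∀ m : ℤ × ℤ × ℤ, m ∈ B ↔ |(m.2.2 : ℝ)| ≤ r3 ∧
      |(m.2.1 : ℝ) + z0 * m.2.2| ≤ r2 ∧ |(m.1 : ℝ) + (x0 * m.2.1 + y0 * m.2.2)| ≤ r1) :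
    B.card ≤ 1 + 2 * (B.filter fun m => 0 < m.2.2).card := by
  classical
  have hneg : ∀ m ∈ B, -m ∈ B := by
    intro m hm
    rw [hB] at hm ⊢
    simp only [Prod.fst_neg, Prod.snd_neg, Int.cast_neg, abs_neg]
    refine ⟨hm.1, ?_, ?_⟩
    · rw [← abs_neg]; refine le_trans (le_of_eq ?_) hm.2.1; congr 1; ring
    · rw [← abs_neg]; refine le_trans (le_of_eq ?_) hm.2.2; congr 1; ring
  have hsub : B ⊆ insert 0 ((B.filter fun m => 0 < m.2.2) ∪
      (B.filter fun m => 0 < m.2.2).image fun m => -m) := by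
    intro m hm
    rw [Finset.mem_insert, Finset.mem_union, Finset.mem_filter, Finset.mem_image]
    rcases lt_trichotomy m.2.2 0 with h | h | h
    · right; right
      exact ⟨-m, Finset.mem_filter.mpr ⟨hneg m hm, by simpa using h⟩, neg_neg m⟩
    · left
      obtain ⟨-, hb, ha⟩ := (hB m).mp hm
      have hz : ∀ n : ℤ, |(n : ℝ)| < 1 → n = 0 := fun n hn =>
        Int.abs_lt_one_iff.mp (by exact_mod_cast hn)
      rw [h] at hb ha
      have hb0 : m.2.1 = 0 := hz _ (by simpa using hb.trans_lt h2)
      rw [hb0] at ha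
      have ha0 : m.1 = 0 := hz _ (by simpa using ha.trans_lt h1)
      exact Prod.ext ha0 (Prod.ext hb0 h)
    · right; left; exact ⟨hm, h⟩
  have c1 := Finset.card_le_card hsub
  have c2 := Finset.card_insert_le (0 : ℤ × ℤ × ℤ) ((B.filter fun m => 0 < m.2.2) ∪
      (B.filter fun m => 0 < m.2.2).image fun m => -m)
  have c3 := Finset.card_union_le (B.filter fun m => 0 < m.2.2)
      ((B.filter fun m => 0 < m.2.2).image fun m => -m)
  have c4 := Finset.card_image_le (s := B.filter fun m => 0 < m.2.2) (f := fun m => -m)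
  omega

/-- The bound `δ Q²` for the number of shifted rational points near a curve, for large `δ`. -/
theorem exists_card_shiftedRationalPoints_le {α β c₁ c₂ : ℝ} (hαβ : α < β) (h1 : 0 < c₁)
    (h2 : 0 ≤ c₂) :
    ∃ K : ℝ, 0 < K ∧ ∀ f g : ℝ → ℝ, QuadraticallyConvexOn (Set.Icc α β) c₁ c₂ f g →
      ∀ (θ : ℝ × ℝ) (Q δ : ℝ), 1 ≤ Q → 0 < δ → δ ≤ 1 → 1 ≤ δ * √δ * Q →
      ∀ A : Finset (ℤ × ℕ), (A : Set (ℤ × ℕ)) ⊆ shiftedRationalPoints f (Set.Icc α β) θ Q δ →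
      (A.card : ℝ) ≤ K * (δ * Q ^ 2) := by
  classical
  obtain ⟨κ₀, K₀, hκ₀, hκ₀1, hK₀, hmain⟩ := exists_card_incidences_le hαβ h1 h2
  have hba : 0 < β - α := sub_pos.mpr hαβ
  -- Here 7 stands for an upper bound of `2π`, and `(4 + c₂) * κ` is the sum of the products of dual
  -- side lengths.
  obtain ⟨κ, hκ, hκκ₀, hκc⟩ : ∃ κ : ℝ, 0 < κ ∧ κ ≤ κ₀ / 2 ∧ 7 * (4 + c₂) * κ ≤ 1 := by
    refine ⟨min (κ₀ / 2) (1 / (7 * (4 + c₂))), by positivity, min_le_left _ _, ?_⟩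
    have := min_le_right (κ₀ / 2) (1 / (7 * (4 + c₂)))
    rwa [le_div_iff₀' (by positivity)] at this
  refine ⟨32 * (β - α + 1 + 2 * K₀) / κ ^ 3, by positivity, ?_⟩
  intro f g hf θ Q δ hQ hδ hδ1 hδQ A hA
  have hQ0 : 0 < Q := by linarith
  have hsδ1 : √δ ≤ 1 := Real.sqrt_le_one.mpr hδ1
  have hsδ : 0 < √δ := Real.sqrt_pos.mpr hδ
  have hQδ : 1 ≤ Q * δ := by
    have : δ * √δ * Q ≤ δ * 1 * Q := by gcongr
    linarith
  -- With this choice the arcs have length `σ / H = δ / s = √(δ / Q)`, and the dual box has volume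
  -- `σ ^ 3`.
  set s := √(Q * δ) with hs
  have hs1 : 1 ≤ s := Real.one_le_sqrt.mpr hQδ
  have hs0 : 0 < s := by linarith
  have hss : s ^ 2 = Q * δ := Real.sq_sqrt (by positivity)
  set σ := κ / s with hσdef
  set H := κ / δ with hHdef
  have hκ1 : κ < 1 := by linarith
  have hσ : 0 < σ := by positivity
  have hH : 0 < H := by positivity
  have hσκ : σ ≤ κ := div_le_self hκ.le hs1
  have hL : σ / H = δ / s := by rw [hσdef, hHdef]; field_simp
  have hτ : σ ^ 2 / H = κ / Q := by
    rw [hσdef, hHdef, div_pow, hss]; field_simp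
  have hL0 : 0 < σ / H := by positivity
  have hL1 : σ / H ≤ 1 := by rw [hL, div_le_one hs0]; linarith
  have hσH : σ ^ 2 * √H ≤ 1 := by
    rw [hσdef, hHdef, div_pow, hss, Real.sqrt_div hκ.le]
    have hk : κ ^ 2 * √κ ≤ 1 := by
      have : √κ ≤ 1 := Real.sqrt_le_one.mpr hκ1.le
      have : κ ^ 2 ≤ 1 := pow_le_one₀ hκ.le hκ1.le
      nlinarith [Real.sqrt_nonneg κ]
    calc κ ^ 2 / (Q * δ) * (√κ / √δ) = κ ^ 2 * √κ / (δ * √δ * Q) := by field_simp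
      _ ≤ 1 / 1 := div_le_div₀ zero_le_one hk one_pos hδQ
      _ = 1 := one_div_one
  let pt : ℤ × ℕ → ℝ := fun a => ((a.1 : ℝ) + θ.1) / (a.2 : ℝ)
  let idx : ℤ × ℕ → ℕ := fun a => ⌊(pt a - α) / (σ / H)⌋₊
  let gr : ℕ → ℝ := fun i => α + i * (σ / H)
  set N := ⌊(β - α) / (σ / H)⌋₊ + 1
  have hNle : (N : ℝ) ≤ (β - α + 1) * (H / σ) := by
    have := Nat.floor_le (a := (β - α) / (σ / H)) (by positivity)
    have h3 : 1 ≤ H / σ := by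
      rw [← inv_div, one_le_inv₀ hL0]; exact hL1
    have e : (β - α) / (σ / H) = (β - α) * (H / σ) := by field_simp
    rw [e] at this
    simp only [N]
    push_cast
    rw [e]
    linarith
  have hAmem : ∀ a ∈ A, 0 ≤ (pt a - α) / (σ / H) ∧ pt a ≤ β := by
    intro a ha
    obtain ⟨-, -, hI, -⟩ := hA ha
    exact ⟨div_nonneg (sub_nonneg.mpr hI.1) hL0.le, hI.2⟩
  have hidx : ∀ a ∈ A, idx a ∈ Finset.range N := by
    intro a ha
    rw [Finset.mem_range, Nat.lt_succ_iff]
    refine Nat.floor_le_floor ?_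
    have := (hAmem a ha).2
    gcongr
  have hgr : ∀ a ∈ A, gr (idx a) ≤ pt a ∧ pt a ≤ gr (idx a) + σ / H := by
    intro a ha
    have e1 := Nat.floor_le (hAmem a ha).1
    have e2 := (Nat.lt_floor_add_one ((pt a - α) / (σ / H))).le
    rw [le_div_iff₀ hL0] at e1
    rw [div_le_iff₀ hL0] at e2
    constructor
    · simp only [gr, idx]; linarith
    · simp only [gr, idx]; linarith
  have hgrI : ∀ i ∈ Finset.range N, gr i ∈ Set.Icc α β := by
    intro i hi
    rw [Finset.mem_range, Nat.lt_succ_iff] at hi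
    have : (i : ℝ) ≤ (β - α) / (σ / H) :=
      le_trans (by exact_mod_cast hi) (Nat.floor_le (by positivity))
    rw [le_div_iff₀ hL0] at this
    refine ⟨?_, ?_⟩
    · simp only [gr]; linarith [mul_nonneg (Nat.cast_nonneg (α := ℝ) i) hL0.le]
    · simp only [gr]; linarith
  let B : ℕ → Finset (ℤ × ℤ × ℤ) := fun i =>
    (finite_dual_box (gr i) (f (gr i)) (g (gr i)) (κ / Q) σ H).toFinset
  have hB : ∀ i m, m ∈ B i ↔ |(m.2.2 : ℝ)| ≤ H ∧ |(m.2.1 : ℝ) + g (gr i) * m.2.2| ≤ σ ∧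
      |(m.1 : ℝ) + (gr i * m.2.1 + f (gr i) * m.2.2)| ≤ κ / Q := fun i m => by
    simp only [B, Set.Finite.mem_toFinset, Set.mem_ofPred_eq]
  have hkQ : κ / Q < 1 := (div_le_self hκ.le hQ).trans_lt hκ1
  have hBcard : ∀ i, (B i).card ≤ 1 + 2 * ((B i).filter fun m => 0 < m.2.2).card := fun i =>
    card_dual_box_le _ _ _ _ _ _ hkQ (hσκ.trans_lt hκ1) (B i) (hB i)
  have hinc : (∑ i ∈ Finset.range N, (((B i).filter fun m => 0 < m.2.2).card : ℝ))
      ≤ K₀ * (H / σ) := by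
    let emb : (i : ℕ) → Finset ((ℤ × ℤ × ℤ) × ℕ) := fun i =>
      ((B i).filter fun m => 0 < m.2.2).image fun m => (m, i)
    have hP := hmain f g hf H σ hH hσ (by linarith) hσH ((Finset.range N).biUnion emb) ?_
    · rw [Finset.card_biUnion] at hP
      · refine le_trans (le_of_eq ?_) hP
        push_cast
        refine Finset.sum_congr rfl fun i _ => ?_
        rw [Finset.card_image_of_injective]
        exact fun m m' h => congrArg Prod.fst h
      · intro i _ j _ hij
        rw [Function.onFun, Finset.disjoint_left]
        intro p hp hp'
        obtain ⟨m, -, rfl⟩ := Finset.mem_image.mp hp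
        obtain ⟨m', -, h⟩ := Finset.mem_image.mp hp'
        exact hij (congrArg Prod.snd h).symm
    · intro p hp
      obtain ⟨i, hi, hp⟩ := Finset.mem_biUnion.mp hp
      obtain ⟨m, hm, rfl⟩ := Finset.mem_image.mp hp
      obtain ⟨hmB, hm0⟩ := Finset.mem_filter.mp hm
      obtain ⟨hc, hb, ha⟩ := (hB i m).mp hmB
      refine ⟨hgrI i hi, hm0, (le_abs_self _).trans hc, ?_, ?_⟩
      · rw [hτ]
        refine le_trans (le_of_eq ?_) ha
        simp only [dualForm, gr]; congr 1; ring
      · refine le_trans (le_of_eq ?_) hb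
        simp only [dualSlope, gr]; congr 1; ring
  have hlocal : ∀ i ∈ Finset.range N,
      ((A.filter fun a => idx a = i).card : ℝ) * σ ^ 3 ≤ 32 * (B i).card := by
    intro i hi
    let lift : ℤ × ℕ → ℤ × ℤ × ℤ := fun a =>
      ((a.2 : ℤ), a.1, round ((a.2 : ℝ) * f (pt a) - θ.2))
    have hinj : Function.Injective lift := by
      rintro ⟨p, q⟩ ⟨p', q'⟩ h
      simp only [lift, Prod.mk.injEq] at h
      exact Prod.ext h.2.1 (by exact_mod_cast h.1)
    have hx0 := hgrI i hi
    -- The shift `θ` enters only through the centre, which the dual box does not see. As `Q < q ≤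
    -- 2Q`, the first coordinate can be centred at `Q` with radius `Q`.
    have key := card_mul_le_card_dual (gr i) (f (gr i)) (g (gr i)) Q (-θ.1)
      (θ.1 * g (gr i) - θ.2) Q (2 * Q * (σ / H)) ((1 + c₂) * δ) (κ / Q) σ H (by positivity) hσ hH ?_
      ((A.filter fun a => idx a = i).image lift) (B i) ?_
      (fun m hc hb ha => (hB i m).mpr ⟨hc, hb, ha⟩)
    · rw [Finset.card_image_of_injective _ hinj, ← hτ] at key
      have e : σ ^ 2 / H * σ * H = σ ^ 3 := by field_simp
      rwa [e] at key
    · have e : Q * (κ / Q) + 2 * Q * (σ / H) * σ + (1 + c₂) * δ * H = (4 + c₂) * κ := by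
        have e1 : Q * (κ / Q) = κ := by field_simp
        have e2 : 2 * Q * (σ / H) * σ = 2 * κ := by
          rw [hL, hσdef]
          have : 2 * Q * (δ / s) * (κ / s) = 2 * κ * (Q * δ) / s ^ 2 := by field_simp
          rw [this, hss]; field_simp
        have e3 : (1 + c₂) * δ * H = (1 + c₂) * κ := by rw [hHdef]; field_simp
        rw [e1, e2, e3]; ring
      rw [e]
      have hpi : 2 * Real.pi ≤ 7 := by linarith [Real.pi_lt_d2]
      calc _ ≤ 7 * ((4 + c₂) * κ) := by gcongr
        _ ≤ 1 := by linarith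
    · intro n hn
      obtain ⟨a, ha, rfl⟩ := Finset.mem_image.mp hn
      obtain ⟨aA, hai⟩ := Finset.mem_filter.mp ha
      obtain ⟨hq1, hq2, hI, hdist⟩ := hA aA
      have hg := hgr a aA
      rw [hai] at hg
      have hq0 : (0 : ℝ) < a.2 := by linarith
      have hpq : (a.1 : ℝ) + θ.1 = a.2 * pt a := by simp only [pt]; field_simp
      have hd0 : |pt a - gr i| ≤ σ / H := by rw [abs_le]; constructor <;> linarith
      have hd1 : |(a.2 : ℝ)| ≤ 2 * Q := by rw [abs_of_pos hq0]; exact hq2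
      simp only [lift, Int.cast_natCast]
      refine ⟨?_, ?_, ?_⟩
      · rw [abs_le]; constructor <;> linarith
      · have e : (a.1 : ℝ) - a.2 * gr i - -θ.1 = a.2 * (pt a - gr i) := by
          linear_combination hpq
        rw [e]
        exact abs_mul_le_mul hd1 hd0
      · set R := round ((a.2 : ℝ) * f (pt a) - θ.2)
        have e : (R : ℝ) - a.2 * f (gr i) - (a.1 - a.2 * gr i) * g (gr i)
            - (θ.1 * g (gr i) - θ.2) = -((a.2 : ℝ) * f (pt a) - θ.2 - R)
              + a.2 * (f (pt a) - f (gr i) - g (gr i) * (pt a - gr i)) := by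
          linear_combination (-g (gr i)) * hpq
        have hrem := (hf.abs_remainder_le h1.le hI hx0).trans
          (mul_le_mul_of_nonneg_left (pow_le_pow_left₀ (abs_nonneg _) hd0 2) (by positivity))
        rw [e]
        refine (abs_add_le _ _).trans ?_
        rw [abs_neg]
        refine (add_le_add (le_of_lt hdist) (abs_mul_le_mul hd1 hrem)).trans (le_of_eq ?_)
        rw [hL, div_pow, hss]
        field_simp
  have hAcard : (A.card : ℝ) = ∑ i ∈ Finset.range N, ((A.filter fun a => idx a = i).card : ℝ) := by
    rw [Finset.card_eq_sum_card_fiberwise hidx]; push_cast; rfl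
  have htotal : (A.card : ℝ) * σ ^ 3 ≤ 32 * (β - α + 1 + 2 * K₀) * (H / σ) := by
    rw [hAcard, Finset.sum_mul]
    calc _ ≤ ∑ i ∈ Finset.range N,
          (32 + 64 * (((B i).filter fun m => 0 < m.2.2).card : ℝ)) := by
          refine Finset.sum_le_sum fun i hi => (hlocal i hi).trans ?_
          have : ((B i).card : ℝ) ≤ 1 + 2 * ((B i).filter fun m => 0 < m.2.2).card := by
            exact_mod_cast hBcard i
          linarith
      _ = 32 * N + 64 * ∑ i ∈ Finset.range N, (((B i).filter fun m => 0 < m.2.2).card : ℝ) := by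
          rw [Finset.sum_add_distrib, ← Finset.mul_sum]; simp; ring
      _ ≤ 32 * ((β - α + 1) * (H / σ)) + 64 * (K₀ * (H / σ)) := by gcongr
      _ = _ := by ring
  have hσ3 : 0 < σ ^ 3 := by positivity
  refine le_of_mul_le_mul_right (htotal.trans (le_of_eq ?_)) hσ3
  have e : δ * Q ^ 2 = s ^ 4 / δ := by
    rw [show s ^ 4 = (s ^ 2) ^ 2 by ring, hss]; field_simp
  rw [e, hσdef, hHdef]
  field_simp

/-! ### Quadratic convexity from the second derivative -/

theorem exists_sub_eq_mul_of_hasDerivWithinAt {a b : ℝ} {h h' : ℝ → ℝ}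
    (hd : ∀ x ∈ Set.Icc a b, HasDerivWithinAt h (h' x) (Set.Icc a b) x) {x y : ℝ}
    (hx : x ∈ Set.Icc a b) (hy : y ∈ Set.Icc a b) (hxy : x < y) :
    ∃ z ∈ Set.Ioo x y, h y - h x = h' z * (y - x) := by
  have hsub : Set.Icc x y ⊆ Set.Icc a b := Set.Icc_subset_Icc hx.1 hy.2
  obtain ⟨z, hz, he⟩ := exists_hasDerivAt_eq_slope h h' hxy
    (fun z hz => ((hd z (hsub hz)).continuousWithinAt).mono hsub)
    (fun z hz => (hd z (hsub ⟨hz.1.le, hz.2.le⟩)).hasDerivAt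
      (Icc_mem_nhds (hx.1.trans_lt hz.1) (hz.2.trans_le hy.2)))
  refine ⟨z, hz, ?_⟩
  rw [he]
  have : y - x ≠ 0 := sub_ne_zero.mpr hxy.ne'
  field_simp

/-- A function with nonnegative second derivative lies above its tangents. -/
theorem tangent_le_of_hasDerivWithinAt {a b : ℝ} {h h' h'' : ℝ → ℝ}
    (hd : ∀ x ∈ Set.Icc a b, HasDerivWithinAt h (h' x) (Set.Icc a b) x)
    (hd' : ∀ x ∈ Set.Icc a b, HasDerivWithinAt h' (h'' x) (Set.Icc a b) x)
    (hnn : ∀ x ∈ Set.Icc a b, 0 ≤ h'' x) {x y : ℝ} (hx : x ∈ Set.Icc a b) (hy : y ∈ Set.Icc a b) :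
    0 ≤ h x - h y - h' y * (x - y) := by
  have hmono : ∀ u ∈ Set.Icc a b, ∀ v ∈ Set.Icc a b, u < v → h' u ≤ h' v := by
    intro u hu v hv huv
    obtain ⟨z, hz, he⟩ := exists_sub_eq_mul_of_hasDerivWithinAt hd' hu hv huv
    have := mul_nonneg (hnn z ⟨hu.1.trans hz.1.le, hz.2.le.trans hv.2⟩) (sub_nonneg.mpr huv.le)
    linarith
  rcases lt_trichotomy x y with hlt | rfl | hlt
  · obtain ⟨z, hz, he⟩ := exists_sub_eq_mul_of_hasDerivWithinAt hd hx hy hlt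
    have := hmono z ⟨hx.1.trans hz.1.le, hz.2.le.trans hy.2⟩ y hy hz.2
    nlinarith [mul_nonneg (sub_nonneg.mpr this) (sub_nonneg.mpr hlt.le)]
  · simp
  · obtain ⟨z, hz, he⟩ := exists_sub_eq_mul_of_hasDerivWithinAt hd hy hx hlt
    have := hmono y hy z ⟨hy.1.trans hz.1.le, hz.2.le.trans hx.2⟩ hz.1
    nlinarith [mul_nonneg (sub_nonneg.mpr this) (sub_nonneg.mpr hlt.le)]

/-- Both `f - c₁ x² / 2` and `c₂ x² / 2 - f` have nonnegative second derivative, hence lie above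
their tangents. -/
theorem quadraticallyConvexOn_of_hasDerivWithinAt {a b c₁ c₂ : ℝ} {f g k : ℝ → ℝ}
    (hd : ∀ x ∈ Set.Icc a b, HasDerivWithinAt f (g x) (Set.Icc a b) x)
    (hd' : ∀ x ∈ Set.Icc a b, HasDerivWithinAt g (k x) (Set.Icc a b) x)
    (hk : ∀ x ∈ Set.Icc a b, c₁ ≤ k x ∧ k x ≤ c₂) :
    QuadraticallyConvexOn (Set.Icc a b) c₁ c₂ f g := by
  have hsq : ∀ (c x : ℝ), HasDerivWithinAt (fun x => c / 2 * x ^ 2) (c * x) (Set.Icc a b) x := by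
    intro c x
    have := ((hasDerivAt_pow 2 x).const_mul (c / 2)).hasDerivWithinAt (s := Set.Icc a b)
    refine this.congr_deriv ?_
    norm_num
    ring
  have hlin : ∀ (c x : ℝ), HasDerivWithinAt (fun x => c * x) c (Set.Icc a b) x := by
    intro c x
    simpa using ((hasDerivAt_id x).const_mul c).hasDerivWithinAt (s := Set.Icc a b)
  intro x hx y hy
  constructor
  · have := tangent_le_of_hasDerivWithinAt (h := fun x => f x - c₁ / 2 * x ^ 2)
      (h' := fun x => g x - c₁ * x) (h'' := fun x => k x - c₁)
      (fun x hx => (hd x hx).sub (hsq c₁ x)) (fun x hx => (hd' x hx).sub (hlin c₁ x))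
      (fun x hx => sub_nonneg.mpr (hk x hx).1) hx hy
    linarith
  · have := tangent_le_of_hasDerivWithinAt (h := fun x => c₂ / 2 * x ^ 2 - f x)
      (h' := fun x => c₂ * x - g x) (h'' := fun x => c₂ - k x)
      (fun x hx => (hsq c₂ x).sub (hd x hx)) (fun x hx => (hlin c₂ x).sub (hd' x hx))
      (fun x hx => sub_nonneg.mpr (hk x hx).2) hx hy
    linarith

theorem quadraticallyConvexOn_of_contDiffOn {a b c₁ c₂ : ℝ} (hab : a < b) {f : ℝ → ℝ}
    (hf : ContDiffOn ℝ 2 f (Set.Icc a b))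
    (hk : ∀ x ∈ Set.Icc a b, c₁ ≤ iteratedDerivWithin 2 f (Set.Icc a b) x ∧
      iteratedDerivWithin 2 f (Set.Icc a b) x ≤ c₂) :
    QuadraticallyConvexOn (Set.Icc a b) c₁ c₂ f (derivWithin f (Set.Icc a b)) := by
  have hu := uniqueDiffOn_Icc hab
  have hg : DifferentiableOn ℝ (derivWithin f (Set.Icc a b)) (Set.Icc a b) :=
    ((contDiffOn_succ_iff_derivWithin (n := 1) hu).mp hf).2.2.differentiableOn (by norm_num)
  refine quadraticallyConvexOn_of_hasDerivWithinAt
    (fun x hx => (hf.differentiableOn (by norm_num) x hx).hasDerivWithinAt)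
    (k := iteratedDerivWithin 2 f (Set.Icc a b)) (fun x hx => ?_) hk
  have e : iteratedDerivWithin 2 f (Set.Icc a b) x
      = derivWithin (derivWithin f (Set.Icc a b)) (Set.Icc a b) x := by
    rw [iteratedDerivWithin_succ]
    exact derivWithin_congr (fun y _ => by rw [iteratedDerivWithin_one])
      (by rw [iteratedDerivWithin_one])
  rw [e]
  exact (hg x hx).hasDerivWithinAt

/-! ### Reflection, finiteness and the final bound -/

theorem distNearestInt_neg (x : ℝ) : distNearestInt (-x) = distNearestInt x := by
  have h : ∀ y : ℝ, distNearestInt (-y) ≤ distNearestInt y := by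
    intro y
    refine (round_le (-y) (-round y)).trans (le_of_eq ?_)
    rw [distNearestInt, ← abs_neg]; congr 1; push_cast; ring
  refine le_antisymm (h x) ?_
  simpa using h (-x)

/-- This reduces negative second derivative to positive, at the price of another shift; uniformity
in `θ` makes that free. -/
theorem shiftedRationalPoints_neg (f : ℝ → ℝ) (I : Set ℝ) (θ : ℝ × ℝ) (Q δ : ℝ) :
    shiftedRationalPoints (fun x => -f x) I (θ.1, -θ.2) Q δ = shiftedRationalPoints f I θ Q δ := by
  ext x
  simp only [shiftedRationalPoints, Set.mem_ofPred_eq]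
  have e : ((x.2 : ℝ) * -f (((x.1 : ℝ) + θ.1) / (x.2 : ℝ)) - -θ.2)
      = -((x.2 : ℝ) * f (((x.1 : ℝ) + θ.1) / (x.2 : ℝ)) - θ.2) := by ring
  rw [e, distNearestInt_neg]

theorem shiftedRationalPoints_mono (f : ℝ → ℝ) (I : Set ℝ) (θ : ℝ × ℝ) (Q : ℝ) {δ δ' : ℝ}
    (h : δ ≤ δ') : shiftedRationalPoints f I θ Q δ ⊆ shiftedRationalPoints f I θ Q δ' :=
  fun _ hx => ⟨hx.1, hx.2.1, hx.2.2.1, hx.2.2.2.trans_le h⟩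

theorem finite_shiftedRationalPoints (f : ℝ → ℝ) (a b : ℝ) (θ : ℝ × ℝ) {Q : ℝ} (hQ : 0 ≤ Q)
    (δ : ℝ) : (shiftedRationalPoints f (Set.Icc a b) θ Q δ).Finite := by
  set M := 2 * Q * (|a| + |b|) + |θ.1|
  refine ((Set.finite_Icc (-⌈M⌉) ⌈M⌉).prod (Set.finite_Iic ⌊2 * Q⌋₊)).subset ?_
  rintro ⟨p, q⟩ ⟨h1, h2, ⟨h3, h4⟩, -⟩
  simp only at h1 h2 h3 h4
  have hq : (0 : ℝ) < q := hQ.trans_lt h1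
  have hy : |((p : ℝ) + θ.1) / q| ≤ |a| + |b| := by
    rw [abs_le]
    constructor
    · linarith [neg_abs_le a, abs_nonneg b]
    · linarith [le_abs_self b, abs_nonneg a]
  have hp : |(p : ℝ)| ≤ M := by
    have e : (p : ℝ) = q * (((p : ℝ) + θ.1) / q) - θ.1 := by field_simp; ring
    rw [e]
    refine (abs_sub _ _).trans (add_le_add (abs_mul_le_mul ?_ hy) le_rfl)
    rwa [abs_of_pos hq]
  have hp' := abs_le.mp hp
  have hM := Int.le_ceil M
  refine ⟨⟨?_, ?_⟩, Nat.le_floor h2⟩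
  · have : (-⌈M⌉ : ℝ) ≤ p := by linarith [hp'.1]
    exact_mod_cast this
  · have : (p : ℝ) ≤ ⌈M⌉ := by linarith [hp'.2]
    exact_mod_cast this

/-- The counting bound for functions lying between parabolas above their tangents. -/
theorem QuadraticallyConvexOn.exists_shiftedRationalCount_le {a b c₁ c₂ : ℝ} (hab : a < b)
    (h1 : 0 < c₁) (h2 : 0 ≤ c₂) {f g : ℝ → ℝ}
    (hf : QuadraticallyConvexOn (Set.Icc a b) c₁ c₂ f g) :
    ∃ C : ℝ, 0 < C ∧ ∀ (θ : ℝ × ℝ) (Q δ : ℝ), 1 ≤ Q → 0 < δ → δ ≤ 1 / 2 →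
      (shiftedRationalPoints f (Set.Icc a b) θ Q δ).Finite ∧
      (shiftedRationalCount f (Set.Icc a b) θ Q δ : ℝ) ≤
        C * (δ * Q ^ 2 + δ ^ (-(1 / 2 : ℝ)) * Q) := by
  obtain ⟨K, hK, hmain⟩ := exists_card_shiftedRationalPoints_le hab h1 h2
  refine ⟨K, hK, fun θ Q δ hQ hδ hδ2 => ?_⟩
  have hQ0 : 0 < Q := by linarith
  have hfin := finite_shiftedRationalPoints f a b θ hQ0.le δ
  refine ⟨hfin, ?_⟩
  rw [shiftedRationalCount, Set.ncard_eq_toFinset_card _ hfin]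
  have hpow : δ ^ (-(1 / 2 : ℝ)) = 1 / √δ := by
    rw [Real.rpow_neg hδ.le, Real.sqrt_eq_rpow, one_div (δ ^ (1 / 2 : ℝ))]
  rw [hpow]
  have hsδ : 0 < √δ := Real.sqrt_pos.mpr hδ
  rcases le_total 1 (δ * √δ * Q) with h | h
  · refine (hmain f g hf θ Q δ hQ hδ (by linarith) h hfin.toFinset (by simp)).trans ?_
    gcongr
    have : 0 ≤ 1 / √δ * Q := by positivity
    linarith
  -- For small `δ`, the threshold `s ^ 2 = Q^(-2/3)`, where `δ^(3/2) Q = 1`, replaces `δ`. The count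
  -- can only grow, and `s ^ 2 * Q ^ 2 = Q / s` is at most `Q / √δ`.
  · set s := Q ^ (-(1 / 3 : ℝ)) with hs
    have hs0 : 0 < s := by positivity
    have hs1 : s ≤ 1 := Real.rpow_le_one_of_one_le_of_nonpos hQ (by norm_num)
    have hs3 : s ^ 3 * Q = 1 := by
      rw [hs, ← Real.rpow_natCast, ← Real.rpow_mul hQ0.le]
      norm_num
      rw [Real.rpow_neg_one]
      exact inv_mul_cancel₀ hQ0.ne'
    have hle : √δ ≤ s := by
      by_contra hcon
      push Not at hcon
      have h3 : s ^ 3 < √δ ^ 3 := pow_lt_pow_left₀ hcon hs0.le (by norm_num)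
      have h4 : √δ ^ 3 = δ * √δ := by rw [pow_succ, Real.sq_sqrt hδ.le]
      rw [h4] at h3
      have := mul_lt_mul_of_pos_right h3 hQ0
      linarith
    have hδs : δ ≤ s ^ 2 := by
      rw [← Real.sq_sqrt hδ.le]; gcongr
    have hb := hmain f g hf θ Q (s ^ 2) hQ (by positivity) (pow_le_one₀ hs0.le hs1)
      (by rw [Real.sqrt_sq hs0.le, ← pow_succ, hs3]) hfin.toFinset
      (by
        rw [Set.Finite.coe_toFinset]
        exact shiftedRationalPoints_mono f _ θ Q hδs)
    refine hb.trans ?_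
    gcongr
    have e : s ^ 2 * Q ^ 2 = 1 / s * Q := by
      have : s ^ 2 * Q ^ 2 = (s ^ 3 * Q) * (1 / s * Q) := by field_simp
      rw [this, hs3, one_mul]
    rw [e]
    have : 1 / s * Q ≤ 1 / √δ * Q := by gcongr
    have : 0 ≤ δ * Q ^ 2 := by positivity
    linarith

theorem mainTheorem3 (a b : ℝ) (hab : a < b) (f : ℝ → ℝ)
    (hf : ContDiffOn ℝ 2 f (Set.Icc a b))
    (hf'' : ∀ x ∈ Set.Icc a b, iteratedDerivWithin 2 f (Set.Icc a b) x ≠ 0) :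
    ∃ C : ℝ, 0 < C ∧ ∀ (θ : ℝ × ℝ) (Q δ : ℝ), 1 ≤ Q → 0 < δ → δ ≤ 1 / 2 →
      (shiftedRationalPoints f (Set.Icc a b) θ Q δ).Finite ∧
      (shiftedRationalCount f (Set.Icc a b) θ Q δ : ℝ) ≤
        C * (δ * Q ^ 2 + δ ^ (-(1 / 2 : ℝ)) * Q) := by
  have hcont : ContinuousOn (iteratedDerivWithin 2 f (Set.Icc a b)) (Set.Icc a b) :=
    hf.continuousOn_iteratedDerivWithin le_rfl (uniqueDiffOn_Icc hab)
  have hne : (Set.Icc a b).Nonempty := Set.nonempty_Icc.mpr hab.le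
  obtain ⟨xm, hxm, hmin⟩ := isCompact_Icc.exists_isMinOn hne hcont
  obtain ⟨xM, hxM, hmax⟩ := isCompact_Icc.exists_isMaxOn hne hcont
  set k := iteratedDerivWithin 2 f (Set.Icc a b) with hk
  -- The sign at the maximum point decides: a negative maximum gives a negative second derivative
  -- throughout, and a positive one forces a positive minimum by the intermediate value theorem.
  rcases lt_or_gt_of_ne (hf'' xM hxM) with hneg | hpos
  · have hq := quadraticallyConvexOn_of_contDiffOn (c₁ := -k xM) (c₂ := -k xm) hab
      (f := fun x => -f x) hf.neg (fun x hx => by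
        have e : iteratedDerivWithin 2 (fun x => -f x) (Set.Icc a b) x = -k x :=
          iteratedDerivWithin_fun_neg f
        rw [e]
        exact ⟨neg_le_neg (hmax hx), neg_le_neg (hmin hx)⟩)
    obtain ⟨C, hC, h⟩ := hq.exists_shiftedRationalCount_le hab (neg_pos.mpr hneg)
      (neg_nonneg.mpr ((hmax hxm).trans hneg.le))
    refine ⟨C, hC, fun θ Q δ hQ hδ hδ2 => ?_⟩
    have := h (θ.1, -θ.2) Q δ hQ hδ hδ2
    simp only [shiftedRationalCount] at this ⊢
    rwa [shiftedRationalPoints_neg] at this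
  · have hpos' : 0 < k xm := by
      by_contra hcon
      push Not at hcon
      obtain ⟨z, hz, hz0⟩ := isPreconnected_Icc.intermediate_value hxm hxM hcont
        (show (0 : ℝ) ∈ Set.Icc (k xm) (k xM) from ⟨hcon, hpos.le⟩)
      exact hf'' z hz hz0
    exact (quadraticallyConvexOn_of_contDiffOn hab hf
      (fun x hx => ⟨hmin hx, hmax hx⟩)).exists_shiftedRationalCount_le hab hpos' hpos.le
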